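/- **Setting.** A *stream specification* $\mathcal T=\langle\Sigma,R\rangle$ is a finite orthogonal constructor term rewriting system over the sorts stream and data, where data symbols take data arguments only, the only constructor of sort stream is $:\,$ (of type data $\times$ stream $\to$ stream), every other stream symbol $f$ takes $k$ stream arguments followed by $\ell$ data arguments (its stream arity $k$ and data arity $\ell$), there is a designated stream constant (the root) without arguments, the data rules are terminating, and $\mathcal T$ is exhaustive: every defined symbol applied to (possibly infinite) closed constructor terms is a redex. We assume that there is at least one closed data constructor term. Every defining rule of $f$ has the form $$\rho:\quad f\big((\vec u_1:\sigma_1),\dots,(\vec u_k:\sigma_k),q_1,\dots,q_\ell\big)\to c_1:\dots:c_m:s,$$ where the root of $s$ is not '$:$'; $\rho$ consumes $|\vec u_i|$ elements of its $i$-th stream argument and produces $m$ elements. A rule is *nesting* if its right-hand side contains nested occurrences of stream symbols other than '$:$'. A rule $\rho$ depends directly on a rule $\gamma$ if the symbol defined by $\gamma$ occurs in the right-hand side of $\rho$; *depends* is the reflexive-transitive closure. A rule is *flat* if all rules on which it depends are non-nesting. It is *friendly* if all rules on which it depends consume at most one element of each stream argument and produce at least one. The *friendly nesting* rules are the largest extension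 of the set of friendly rules by non-nesting rules that is closed under dependency. A stream symbol other than '$:$' is flat (friendly nesting) if all its defining rules are; flat symbols are friendly nesting. A stream symbol $f$ is *weakly guarded* if there is no infinite sequence $f=f_0,f_1,f_2,\dots$ such that for all $j$ some defining rule of $f_j$ has a right-hand side with root $f_{j+1}\neq{:}$; otherwise $f$ is *unguarded*. **Lower bound.** Let $\overline{\mathbb N}=\mathbb N\cup\{\infty\}$. Let $\lfloor t\rfloor$ be the result of replacing all data subterms of a stream term $t$ by $\bullet$. A *data-exchange function* $G$ maps every data-abstracted stream term $r$ to a stream term $G(r)$ with $\lfloor G(r)\rfloor=r$ all of whose data subterms are closed constructor terms. Let $r\to_G\lfloor t\rfloor$ whenever $G(r)\to_{\mathcal T}t$, and let $\Pi_G(r)=\sup\{n\in\mathbb N: r\to_G^*\bullet^n:t\text{ for some }t\}$. The *data-oblivious lower bound* $\underline{do}_{\mathcal T}(f):\overline{\mathbb N}^k\to\overline{\mathbb N}$ on the production of $f$ is $$\underline{do}_{\mathcal T}(f)(n_1,\dots,n_k)=\inf_G\,\Pi_G\big(f((\bullet^{n_1}:\sigma_1),\dots,(\bullet^{n_k}:\sigma_k),\bullet,\dots,\bullet)\big),$$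 where $\bullet^\infty:\sigma$ is the infinite term $\bullet:\bullet:\cdots$. **Translation.** Consider the following system of equations, for all friendly nesting $f$ (with stream arity $k$), $1\le i\le k$ and $n,n_1,\dots,n_k\in\overline{\mathbb N}$, with $\inf\emptyset=\infty$: $$X_f(n_1,\dots,n_k)=\min(X_{f,\star},X_{f,1}(n_1),\dots,X_{f,k}(n_k)),$$ $X_{f,\star}=\inf_\rho X_{f,\star,\rho}$ and $X_{f,i}(n)=\inf_\rho X_{f,i,\rho}(n)$ over the defining rules $\rho$ of $f$ if $f$ is weakly guarded, and $X_{f,\star}=X_{f,i}(n)=0$ if $f$ is unguarded. If $\rho$ is nesting, then $X_{f,\star,\rho}=\infty$ and $X_{f,i,\rho}(n)=n$. If $\rho$ is non-nesting, then in the form above either (a) $s=\sigma_j$ or (b) $s=g((\vec d_1:\sigma_{\pi(1)}),\dots,(\vec d_{k'}:\sigma_{\pi(k')}),e_1,\dots,e_{\ell'})$, and $X_{f,\star,\rho}$ is $\infty$ in case (a) and $m+X_{g,\star}$ in case (b); moreover $X_{f,i,\rho}(n)=0$ if $n<|\vec u_i|$, and otherwise, with $n'=n-|\vec u_i|$, $$X_{f,i,\rho}(n)=m+\begin{cases}n'&\text{(a),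 }i=j\\ \infty&\text{(a), }i\ne j\\ \inf\{X_{g,j}(n'+|\vec d_j|): \pi(j)=i\}&\text{(b)}.\end{cases}$$ A function $h:\overline{\mathbb N}\to\overline{\mathbb N}$ is *periodically increasing* if on $\mathbb N$ it is nondecreasing with eventually periodic derivative $n\mapsto h(n+1)-h(n)$ (where $\infty-\infty=0$), and $h(\infty)=\lim_{n\to\infty}h(n)$. A function $h:\overline{\mathbb N}^k\to\overline{\mathbb N}$ is periodically increasing if $h(n_1,\dots,n_k)=\min(c,h_1(n_1),\dots,h_k(n_k))$ for a constant $c\in\overline{\mathbb N}$ and unary periodically increasing functions $h_1,\dots,h_k$. **Lemma.** Let $\mathcal T$ be a stream specification and let $f$ be a friendly nesting symbol of $\mathcal T$ (for instance a flat one). The system has exactly one solution $[f]:\overline{\mathbb N}^k\to\overline{\mathbb N}$ for $X_f$, and: 1. If $f$ is flat, then $[f]=\underline{do}_{\mathcal T}(f)$. Hence $\underline{do}_{\mathcal T}(f)$ is periodically increasing. 2. If $f$ is friendly nesting, then $[f](n_1,\dots,n_k)\le\underline{do}_{\mathcal T}(f)(n_1,\dots,n_k)$ for all $n_1,\dots,n_k\in\overline{\mathbb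 N}$. -/

import Mathlib

universe u

/-- A finite `{stream, data}`-sorted signature.  Data symbols take data arguments only.  `SSym` is
the set of stream symbols other than the stream constructor `:`, with the stream arguments in front;
`sAr` is the stream arity and `dAr` the data arity of such a symbol. -/
structure StreamSig where
  DSym : Type u
  SSym : Type u
  finiteD : Finite DSym
  finiteS : Finite SSym
  ar : DSym → ℕ
  sAr : SSym → ℕ
  dAr : SSym → ℕ

/-- Terms of sort data, with variables from `ℕ`. -/
inductive DTerm (S : StreamSig.{u}) : Type u
  | var (x : ℕ) : DTerm S
  | app (d : S.DSym) (args : Fin (S.ar d) → DTerm S) : DTerm S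

namespace DTerm

variable {S : StreamSig.{u}}

def subst (τ : ℕ → DTerm S) : DTerm S → DTerm S
  | var x => τ x
  | app d args => app d (fun i => subst τ (args i))

/-- The list of occurrences of variables. -/
def vars : DTerm S → List ℕ
  | var x => [x]
  | app _ args => (List.ofFn (fun i => vars (args i))).flatten

/-- All function symbols satisfy `C`; variables are allowed. -/
def SymsIn (C : S.DSym → Prop) : DTerm S → Prop
  | var _ => True
  | app d args => C d ∧ ∀ i, SymsIn C (args i)

/-- Closed, and all function symbols satisfy `C`. -/
def Closed (C : S.DSym → Prop) : DTerm S → Prop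
  | var _ => False
  | app d args => C d ∧ ∀ i, Closed C (args i)

end DTerm

/-- Finite terms of sort stream with stream variables from `Y`.  Every such term can be written in
exactly one way as `u₁ : … : uₘ : y` with a variable `y` (this is `var [u₁, …, uₘ] y`), or as
`u₁ : … : uₘ : g(s₁, …, sₖ, v₁, …, vₗ)` (this is `app [u₁, …, uₘ] g s v`). -/
inductive FinTerm (S : StreamSig.{u}) (Y : Type) : Type u
  | var (us : List (DTerm S)) (y : Y) : FinTerm S Y
  | app (us : List (DTerm S)) (g : S.SSym) (args : Fin (S.sAr g) → FinTerm S Y)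
      (vs : Fin (S.dAr g) → DTerm S) : FinTerm S Y

namespace FinTerm

variable {S : StreamSig.{u}} {Y : Type}

/-- The number `m` of stream elements in front, for a term `u₁ : … : uₘ : s` where the root of `s`
is not `:`. -/
def prefixLength : FinTerm S Y → ℕ
  | var us _ => us.length
  | app us _ _ _ => us.length

/-- The term contains a stream symbol different from `:`, that is, it is not of the form
`u₁ : … : uₘ : y` with a variable `y`. -/
def IsApp : FinTerm S Y → Prop
  | var _ _ => False
  | app _ _ _ _ => True

/-- The symbol `f` occurs in the term. -/
def Occurs (f : S.SSym) : FinTerm S Y → Prop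
  | var _ _ => False
  | app _ g args _ => g = f ∨ ∃ i, Occurs f (args i)

/-- There are nested occurrences of stream symbols different from `:`. -/
def Nested : FinTerm S Y → Prop
  | var _ _ => False
  | app _ _ args _ => ∃ i, IsApp (args i)

/-- The list of occurrences of data variables. -/
def dvars : FinTerm S Y → List ℕ
  | var us _ => (us.map DTerm.vars).flatten
  | app us _ args vs => (us.map DTerm.vars).flatten
      ++ (List.ofFn (fun i => dvars (args i))).flatten
      ++ (List.ofFn (fun i => (vs i).vars)).flatten

end FinTerm

/-- Terms of sort stream with stream variables from `ℕ`, in which infinite streams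
`u₀ : u₁ : u₂ : …` of data terms may occur as subterms (`inf`).  As for finite terms, every term has
exactly one representation. -/
inductive StrTerm (S : StreamSig.{u}) : Type u
  | inf (us : ℕ → DTerm S) : StrTerm S
  | var (us : List (DTerm S)) (y : ℕ) : StrTerm S
  | app (us : List (DTerm S)) (g : S.SSym) (args : Fin (S.sAr g) → StrTerm S)
      (vs : Fin (S.dAr g) → DTerm S) : StrTerm S

/-- Data-abstracted terms of sort stream: all data terms are replaced by the pebble `•`.
`inf` is `• : • : • : …`, `var n y` is `•ⁿ : y`, and `app n g s` is `•ⁿ : g(s₁, …, sₖ, •, …, •)`. -/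
inductive AbsTerm (S : StreamSig.{u}) : Type u
  | inf : AbsTerm S
  | var (n : ℕ) (y : ℕ) : AbsTerm S
  | app (n : ℕ) (g : S.SSym) (args : Fin (S.sAr g) → AbsTerm S) : AbsTerm S

namespace StrTerm

variable {S : StreamSig.{u}}

/-- `prepend [w₁, …, wₙ] t` is `w₁ : … : wₙ : t`. -/
def prepend (ws : List (DTerm S)) : StrTerm S → StrTerm S
  | inf us => inf (fun n => if h : n < ws.length then ws[n] else us (n - ws.length))
  | var us y => var (ws ++ us) y
  | app us g args vs => app (ws ++ us) g args vs

/-- The instance of a finite term under a substitution `τ` for the data variables and `θ` for the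
stream variables. -/
def inst {Y : Type} (τ : ℕ → DTerm S) (θ : Y → StrTerm S) : FinTerm S Y → StrTerm S
  | .var us y => prepend (us.map (DTerm.subst τ)) (θ y)
  | .app us g args vs =>
      app (us.map (DTerm.subst τ)) g (fun i => inst τ θ (args i)) (fun i => (vs i).subst τ)

/-- Data abstraction. -/
def abs : StrTerm S → AbsTerm S
  | inf _ => .inf
  | var us y => .var us.length y
  | app us g args _ => .app us.length g (fun i => abs (args i))

/-- All data subterms are closed terms over symbols that satisfy `C`. -/
def DataClosed (C : S.DSym → Prop) : StrTerm S → Prop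
  | inf us => ∀ n, (us n).Closed C
  | var us _ => ∀ v ∈ us, v.Closed C
  | app us _ args vs =>
      (∀ v ∈ us, v.Closed C) ∧ (∀ i, DataClosed C (args i)) ∧ ∀ i, (vs i).Closed C

end StrTerm

namespace AbsTerm

variable {S : StreamSig.{u}}

/-- `•ⁿ : t`. -/
def prepend (n : ℕ) : AbsTerm S → AbsTerm S
  | inf => inf
  | var m y => var (n + m) y
  | app m g args => app (n + m) g args

/-- `•ⁿ : y` for `n ∈ ℕ ∪ {∞}`, the infinite term `• : • : …` if `n = ∞`. -/
def pebbles (n : ℕ∞) (y : ℕ) : AbsTerm S :=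
  match n with
  | none => inf
  | some n => var n y

end AbsTerm

/-- A rule `d(p₁, …, pₗ) → r` of sort data. -/
structure DataRule (S : StreamSig.{u}) (d : S.DSym) where
  pats : Fin (S.ar d) → DTerm S
  rhs : DTerm S

namespace DataRule

variable {S : StreamSig.{u}} {d : S.DSym}

def lhsVars (ρ : DataRule S d) : List ℕ := (List.ofFn (fun i => (ρ.pats i).vars)).flatten

/-- The left-hand sides (with variables renamed apart) have a common instance. -/
def Overlap (ρ ρ' : DataRule S d) : Prop :=
  ∃ τ τ' : ℕ → DTerm S, ∀ i, (ρ.pats i).subst τ = (ρ'.pats i).subst τ'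

end DataRule

/-- A rule `f((u⃗₁ : σ₁), …, (u⃗ₖ : σₖ), q₁, …, qₗ) → r` of sort stream, where `pats i` is the list
`u⃗ᵢ`, and where the stream variable `σᵢ` is represented by `i`.  Since `:` is the only stream
constructor, all stream arguments of the left-hand side of a left-linear constructor rule have this
form, and by the indexing the stream variables are pairwise distinct, and those of `r` occur on the
left. -/
structure StreamRule (S : StreamSig.{u}) (f : S.SSym) where
  pats : Fin (S.sAr f) → List (DTerm S)
  dpats : Fin (S.dAr f) → DTerm S
  rhs : FinTerm S (Fin (S.sAr f))

namespace StreamRule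

variable {S : StreamSig.{u}} {f : S.SSym}

def lhsVars (ρ : StreamRule S f) : List ℕ :=
  (List.ofFn (fun i => ((ρ.pats i).map DTerm.vars).flatten)).flatten
    ++ (List.ofFn (fun i => (ρ.dpats i).vars)).flatten

/-- The instance of the `i`-th stream argument of the left-hand side. -/
def instPat (ρ : StreamRule S f) (τ : ℕ → DTerm S) (θ : Fin (S.sAr f) → StrTerm S)
    (i : Fin (S.sAr f)) : StrTerm S :=
  StrTerm.prepend ((ρ.pats i).map (DTerm.subst τ)) (θ i)

/-- The left-hand sides (with variables renamed apart) have a common instance. -/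
def Overlap (ρ ρ' : StreamRule S f) : Prop :=
  ∃ (τ τ' : ℕ → DTerm S) (θ θ' : Fin (S.sAr f) → StrTerm S),
    (∀ i, ρ.instPat τ θ i = ρ'.instPat τ' θ' i) ∧
      ∀ i, (ρ.dpats i).subst τ = (ρ'.dpats i).subst τ'

end StreamRule

/-- The rewrite relation on data terms. -/
inductive DataStep {S : StreamSig.{u}} (R : ∀ d, Set (DataRule S d)) : DTerm S → DTerm S → Prop
  | root {d : S.DSym} (ρ : DataRule S d) (hρ : ρ ∈ R d) (τ : ℕ → DTerm S) :
      DataStep R (.app d (fun i => (ρ.pats i).subst τ)) (ρ.rhs.subst τ)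
  | arg {d : S.DSym} (args : Fin (S.ar d) → DTerm S) (i : Fin (S.ar d)) (t : DTerm S)
      (h : DataStep R (args i) t) :
      DataStep R (.app d args) (.app d (Function.update args i t))

/-- A stream specification: a finite two-sorted orthogonal constructor term rewriting system whose
only stream constructor is `:`, with a root constant, with a terminating data layer, and exhaustive
for all defined symbols. -/
structure StreamSpec extends StreamSig.{u} where
  /-- the defining rules of the data symbols -/
  dataRules : ∀ d, Set (DataRule toStreamSig d)
  /-- the defining rules of the stream symbols -/
  rules : ∀ f, Set (StreamRule toStreamSig f)
  finite_dataRules : ∀ d, (dataRules d).Finite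
  finite_rules : ∀ f, (rules f).Finite
  /-- the root, a stream constant without arguments -/
  root : SSym
  root_sAr : sAr root = 0
  root_dAr : dAr root = 0
  -- Arguments of left-hand sides are constructor terms; a data symbol is a constructor if it has
  -- no defining rule.
  ctor_data : ∀ d, ∀ ρ ∈ dataRules d, ∀ i, (ρ.pats i).SymsIn (fun c => dataRules c = ∅)
  ctor_stream : ∀ f, ∀ ρ ∈ rules f,
    (∀ i, ∀ v ∈ ρ.pats i, v.SymsIn (fun c => dataRules c = ∅)) ∧
      ∀ i, (ρ.dpats i).SymsIn (fun c => dataRules c = ∅)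
  -- Variables on the right occur on the left.
  vars_data : ∀ d, ∀ ρ ∈ dataRules d, ρ.rhs.vars ⊆ ρ.lhsVars
  vars_stream : ∀ f, ∀ ρ ∈ rules f, ρ.rhs.dvars ⊆ ρ.lhsVars
  -- Orthogonality: left-linear and non-overlapping.  In a constructor system, overlaps can only
  -- be at the root.
  linear_data : ∀ d, ∀ ρ ∈ dataRules d, ρ.lhsVars.Nodup
  linear_stream : ∀ f, ∀ ρ ∈ rules f, ρ.lhsVars.Nodup
  nonoverlap_data : ∀ d, ∀ ρ ∈ dataRules d, ∀ ρ' ∈ dataRules d, ρ ≠ ρ' → ¬ ρ.Overlap ρ'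
  nonoverlap_stream : ∀ f, ∀ ρ ∈ rules f, ∀ ρ' ∈ rules f, ρ ≠ ρ' → ¬ ρ.Overlap ρ'
  /-- the data layer is strongly normalising -/
  terminating : WellFounded (fun t s => DataStep dataRules s t)
  -- Exhaustiveness: every defined symbol applied to closed constructor terms (the closed
  -- constructor terms of sort stream are the infinite streams of closed data constructor terms)
  -- is a redex.
  exhaustive_data : ∀ d, dataRules d ≠ ∅ → ∀ args : Fin (ar d) → DTerm toStreamSig,
    (∀ i, (args i).Closed (fun c => dataRules c = ∅)) →
    ∃ ρ ∈ dataRules d, ∃ τ : ℕ → DTerm toStreamSig, ∀ i, args i = (ρ.pats i).subst τ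
  exhaustive_stream : ∀ f, ∀ (us : Fin (sAr f) → ℕ → DTerm toStreamSig)
    (vs : Fin (dAr f) → DTerm toStreamSig),
    (∀ i n, (us i n).Closed (fun c => dataRules c = ∅)) →
    (∀ i, (vs i).Closed (fun c => dataRules c = ∅)) →
    ∃ ρ ∈ rules f, ∃ (τ : ℕ → DTerm toStreamSig) (θ : Fin (sAr f) → StrTerm toStreamSig),
      (∀ i, StrTerm.inf (us i) = ρ.instPat τ θ i) ∧ ∀ i, vs i = (ρ.dpats i).subst τ
  /-- there is data at all -/
  data_nonempty : ∃ v : DTerm toStreamSig, v.Closed (fun c => dataRules c = ∅)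

namespace StreamSpec

variable (T : StreamSpec.{u})

/-- The rewrite relation of the specification on terms of sort stream. -/
inductive Step : StrTerm T.toStreamSig → StrTerm T.toStreamSig → Prop
  | root {f : T.SSym} (ρ : StreamRule T.toStreamSig f) (hρ : ρ ∈ T.rules f)
      (τ : ℕ → DTerm T.toStreamSig) (θ : Fin (T.sAr f) → StrTerm T.toStreamSig)
      (us : List (DTerm T.toStreamSig)) :
      Step (.app us f (ρ.instPat τ θ) (fun i => (ρ.dpats i).subst τ))
        (.prepend us (.inst τ θ ρ.rhs))
  | arg {f : T.SSym} (us : List (DTerm T.toStreamSig))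
      (args : Fin (T.sAr f) → StrTerm T.toStreamSig) (vs : Fin (T.dAr f) → DTerm T.toStreamSig)
      (i : Fin (T.sAr f)) (t : StrTerm T.toStreamSig) (h : Step (args i) t) :
      Step (.app us f args vs) (.app us f (Function.update args i t) vs)
  | dataArg {f : T.SSym} (us : List (DTerm T.toStreamSig))
      (args : Fin (T.sAr f) → StrTerm T.toStreamSig) (vs : Fin (T.dAr f) → DTerm T.toStreamSig)
      (i : Fin (T.dAr f)) (v : DTerm T.toStreamSig) (h : DataStep T.dataRules (vs i) v) :
      Step (.app us f args vs) (.app us f args (Function.update vs i v))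
  | elem (us : List (DTerm T.toStreamSig)) (v v' : DTerm T.toStreamSig)
      (t : StrTerm T.toStreamSig) (h : DataStep T.dataRules v v') :
      Step (.prepend (us ++ [v]) t) (.prepend (us ++ [v']) t)

/-- A data-exchange function: it assigns to every data-abstracted stream term `r` a stream term
with data abstraction `r`, all of whose data subterms are closed constructor terms. -/
def IsDataExchange (G : AbsTerm T.toStreamSig → StrTerm T.toStreamSig) : Prop :=
  ∀ r, (G r).abs = r ∧ (G r).DataClosed (fun c => T.dataRules c = ∅)

/-- Data-oblivious rewriting with respect to `G`: data is exchanged according to `G` before every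
step. -/
def ObliviousStep (G : AbsTerm T.toStreamSig → StrTerm T.toStreamSig)
    (s t : AbsTerm T.toStreamSig) : Prop :=
  ∃ t', T.Step (G s) t' ∧ t'.abs = t

/-- The production of `s` with respect to `G`: the supremum of all `n ∈ ℕ` such that `s` rewrites to
a term of the form `•ⁿ : t`. -/
noncomputable def production (G : AbsTerm T.toStreamSig → StrTerm T.toStreamSig)
    (s : AbsTerm T.toStreamSig) : ℕ∞ :=
  sSup {m | ∃ n : ℕ, m = n ∧ ∃ t, Relation.ReflTransGen (T.ObliviousStep G) s (.prepend n t)}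

/-- The data-oblivious lower bound on the production of a data-abstracted stream term. -/
noncomputable def termDoLow (s : AbsTerm T.toStreamSig) : ℕ∞ :=
  sInf {m | ∃ G, T.IsDataExchange G ∧ m = T.production G s}

/-- The data-oblivious lower bound on the production of a stream symbol `f`: at `n₁, …, nₖ` it is
the lower bound for `f((•^n₁ : σ₁), …, (•^nₖ : σₖ), •, …, •)`. -/
noncomputable def doLow (f : T.SSym) (n : Fin (T.sAr f) → ℕ∞) : ℕ∞ :=
  T.termDoLow (.app 0 f (fun i => .pebbles (n i) i))

/-- The stream rules of `T`. -/
def Rule : Type u := Σ f : T.SSym, {ρ : StreamRule T.toStreamSig f // ρ ∈ T.rules f}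

/-- `ρ` depends directly on `γ`: the symbol defined by `γ` occurs in the right-hand side of `ρ`. -/
def Depends (ρ γ : T.Rule) : Prop := ρ.2.1.rhs.Occurs γ.1

/-- A rule is nesting if its right-hand side has nested occurrences of stream symbols other than
`:`. -/
def NestingRule (ρ : T.Rule) : Prop := ρ.2.1.rhs.Nested

/-- A rule is friendly if every rule on which it depends (itself included) consumes at most one
element from each stream argument and produces at least one element. -/
def FriendlyRule (ρ : T.Rule) : Prop :=
  ∀ γ, Relation.ReflTransGen T.Depends ρ γ →
    (∀ i, (γ.2.1.pats i).length ≤ 1) ∧ 1 ≤ γ.2.1.rhs.prefixLength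

/-- A rule is flat if every rule on which it depends (itself included) is non-nesting. -/
def FlatRule (ρ : T.Rule) : Prop :=
  ∀ γ, Relation.ReflTransGen T.Depends ρ γ → ¬ T.NestingRule γ

/-- The friendly nesting rules form the largest extension of the set of friendly rules by
non-nesting rules that is closed under dependency. -/
def FriendlyNestingRule (ρ : T.Rule) : Prop :=
  ∀ γ, Relation.ReflTransGen T.Depends ρ γ → T.FriendlyRule γ ∨ ¬ T.NestingRule γ

def Flat (f : T.SSym) : Prop := ∀ ρ, T.FlatRule ⟨f, ρ⟩

def FriendlyNesting (f : T.SSym) : Prop := ∀ ρ, T.FriendlyNestingRule ⟨f, ρ⟩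

theorem Flat.friendlyNesting {T : StreamSpec.{u}} {f : T.SSym} (h : T.Flat f) :
    T.FriendlyNesting f :=
  fun ρ γ hγ => Or.inr (h ρ γ hγ)

/-- There is a rule for `f` whose right-hand side has the root `g`, other than `:`. -/
def UnguardedDep (f g : T.SSym) : Prop :=
  ∃ ρ ∈ T.rules f, ∃ args vs, ρ.rhs = .app [] g args vs

/-- `f` is weakly guarded: strongly normalising with respect to `UnguardedDep`. -/
def WeaklyGuarded (f : T.SSym) : Prop := Acc (fun g f => T.UnguardedDep f g) f

/-- Values for the unknowns `X_f`, `X_{f,⋆}` and `X_{f,i}` of the system that defines the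
translation. -/
structure Valuation where
  fn : ∀ f : T.SSym, (Fin (T.sAr f) → ℕ∞) → ℕ∞
  star : T.SSym → ℕ∞
  arg : ∀ f : T.SSym, Fin (T.sAr f) → ℕ∞ → ℕ∞

variable {T}

open Classical in
/-- The right-hand side of the equation for `X_{f,⋆,ρ}`. -/
noncomputable def Valuation.starRule (X : T.Valuation) {f : T.SSym}
    (ρ : StreamRule T.toStreamSig f) : ℕ∞ :=
  if ρ.rhs.Nested then ⊤
  else match ρ.rhs with
    | .var _ _ => ⊤
    | .app cs g _ _ => cs.length + X.star g

open Classical in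
/-- The right-hand side of the equation for `X_{f,i,ρ}(n)`.  For a non-nesting rule with right-hand
side `c₁ : … : cₘ : g(s₁, …, sₖ', …)`, every `sⱼ` has the form `d⃗ⱼ : σ_π(j)`. -/
noncomputable def Valuation.argRule (X : T.Valuation) {f : T.SSym}
    (ρ : StreamRule T.toStreamSig f) (i : Fin (T.sAr f)) (n : ℕ∞) : ℕ∞ :=
  if ρ.rhs.Nested then n
  else if n < (ρ.pats i).length then 0
  else match ρ.rhs with
    | .var cs j => cs.length + if i = j then n - (ρ.pats i).length else ⊤
    | .app cs g args _ => cs.length + ⨅ j, match args j with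
        | .var ds p => if p = i then X.arg g j (n - (ρ.pats i).length + ds.length) else ⊤
        | .app _ _ _ _ => ⊤

open Classical in
/-- `X` solves the system of defining equations, which has equations for all flat or friendly
nesting symbols. -/
def Valuation.IsSolution (X : T.Valuation) : Prop :=
  ∀ f, T.FriendlyNesting f →
    (∀ n, X.fn f n = min (X.star f) (⨅ i, X.arg f i (n i))) ∧
    (X.star f = if T.WeaklyGuarded f then ⨅ ρ ∈ T.rules f, X.starRule ρ else 0) ∧
    ∀ i n, X.arg f i n = if T.WeaklyGuarded f then ⨅ ρ ∈ T.rules f, X.argRule ρ i n else 0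

variable (T)

/-- `φ` is a solution for `X_f` of the system of defining equations. -/
def IsTranslation (f : T.SSym) (φ : (Fin (T.sAr f) → ℕ∞) → ℕ∞) : Prop :=
  ∃ X : T.Valuation, X.IsSolution ∧ X.fn f = φ

end StreamSpec

/-- A unary function on `ℕ ∪ {∞}` is periodically increasing if on `ℕ` it is nondecreasing with
eventually periodic derivative, and its value at `∞` is the limit. -/
def PeriodicallyIncreasing₁ (h : ℕ∞ → ℕ∞) : Prop :=
  (∀ n : ℕ, h n ≤ h (n + 1 : ℕ)) ∧
  (∃ N p : ℕ, 0 < p ∧ ∀ n : ℕ, N ≤ n →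
    h (n + p + 1 : ℕ) - h (n + p : ℕ) = h (n + 1 : ℕ) - h n) ∧
  h ⊤ = ⨆ n : ℕ, h n

/-- A `k`-ary function is periodically increasing if it is a minimum of unary periodically
increasing functions of the single arguments, and of a constant.  (For `k ≥ 1`, the constant can be
absorbed into one of the unary functions; for `k = 0`, all functions are periodically
increasing.) -/
def PeriodicallyIncreasing {k : ℕ} (h : (Fin k → ℕ∞) → ℕ∞) : Prop :=
  ∃ (c : ℕ∞) (g : Fin k → ℕ∞ → ℕ∞), (∀ i, PeriodicallyIncreasing₁ (g i)) ∧
    ∀ n, h n = min c (⨅ i, g i (n i))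

/-! The system is monotone in its unknowns, so a least fixed point solves it. Each unknown `X_{f,⋆}`
or `X_{f,i}` is the minimal output of a computation on a finite graph with one counter: passing from
a symbol to the root of a right-hand side outputs the produced elements, takes the consumed elements
from the counter and adds those in front of the next argument; a computation that lacks input is
blocked and outputs nothing more. Weak guardedness makes the edges without output well-founded.
Hence a finite value can be analysed by induction on the value and, for equal values, along edges
without output; this gives uniqueness, monotonicity and continuity at infinity
(`le_of_isSolutionAt`, `val_top_le`).

Periodicity (`exists_quasi_linear`) concerns the case of finite unbounded values. Let `D₀ / M₀` be
the largest ratio of net consumption to output over short closed walks. Removing closed walks shows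
that the value at `n` is at least `(M₀ / D₀) n` up to a constant; running around the best closed
walk until the input is exhausted gives the matching upper bound. An optimal walk for large `n` must
therefore meet a closed walk of the best ratio, and repeating that closed walk shows that over a
suitable period the value grows by at most a fixed amount `R`. Together with the lower slope, the
growth is eventually exactly `R`.

For the lower estimate (`le_production_of_le_fn`) the root is rewritten with whatever rule the data
selects, and the equation for that rule yields the production. A nesting rule of a friendly nesting
symbol is friendly, and terms over friendly symbols lose at most one element per argument while they
gain at least one, so they produce at least the minimum of the inputs. For the upper estimate
(`doLow_le_fn`) an adversary chooses data that matches a rule attaining the minimum; by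
orthogonality no other rule applies. For flat symbols every reachable term has at most one stream
symbol, and the pebbles produced plus the value of that symbol never exceed the initial value. -/

/-! ### Walks with output and net consumption -/

/-- Walks of a given length in a graph with doubly weighted edges; both weights are summed up. -/
inductive Walk {V : Type*} (E : V → V → ℕ → ℤ → Prop) : V → V → ℕ → ℕ → ℤ → Prop
  | nil (v : V) : Walk E v v 0 0 0
  | cons {v w x : V} {m : ℕ} {δ : ℤ} {l M : ℕ} {D : ℤ} (e : E v w m δ) (h : Walk E w x l M D) :
      Walk E v x (l + 1) (m + M) (δ + D)

namespace Walk

variable {V : Type*} {E : V → V → ℕ → ℤ → Prop}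

theorem append {u v w : V} {l l' M M' : ℕ} {D D' : ℤ} (h : Walk E u v l M D)
    (h' : Walk E v w l' M' D') : Walk E u w (l + l') (M + M') (D + D') := by
  induction h with
  | nil => simpa using h'
  | cons e _ ih =>
    have := Walk.cons e (ih h')
    convert this using 1 <;> ring

theorem cast {u v : V} {l l' M M' : ℕ} {D D' : ℤ} (h : Walk E u v l M D) (hl : l = l')
    (hM : M = M') (hD : D = D') : Walk E u v l' M' D' := by
  subst hl hM hD; exact h

theorem iterate {u : V} {l M : ℕ} {D : ℤ} (h : Walk E u u l M D) (t : ℕ) :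
    Walk E u u (t * l) (t * M) (t * D) := by
  induction t with
  | zero => exact (Walk.nil u).cast (by simp) (by simp) (by simp)
  | succ t ih => exact (ih.append h).cast (by ring) (by ring) (by push_cast; ring)

theorem mono {E' : V → V → ℕ → ℤ → Prop} (hE : ∀ v w m δ, E v w m δ → E' v w m δ) {u v : V}
    {l M : ℕ} {D : ℤ} (h : Walk E u v l M D) : Walk E' u v l M D := by
  induction h with
  | nil => exact .nil _
  | cons e _ ih => exact .cons (hE _ _ _ _ e) ih

theorem mem_of_closed {S : V → Prop} (hS : ∀ v w m δ, E v w m δ → S v → S w) {u v : V}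
    {l M : ℕ} {D : ℤ} (h : Walk E u v l M D) (hu : S u) : S v := by
  induction h with
  | nil => exact hu
  | cons e _ ih => exact ih (hS _ _ _ _ e hu)

theorem le_length_mul {Δ : ℤ} (hΔ : ∀ v w m δ, E v w m δ → δ ≤ Δ) {u v : V}
    {l M : ℕ} {D : ℤ} (h : Walk E u v l M D) : D ≤ l * Δ := by
  induction h with
  | nil => simp
  | cons e _ ih => have := hΔ _ _ _ _ e; push_cast; linarith

theorem output_le_length_mul {μ : ℕ} (hμ : ∀ v w m δ, E v w m δ → m ≤ μ) {u v : V}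
    {l M : ℕ} {D : ℤ} (h : Walk E u v l M D) : M ≤ l * μ := by
  induction h with
  | nil => simp
  | cons e _ ih => have := hμ _ _ _ _ e; linarith

/-- Vertices and partial sums indexed by position allow a walk to be cut at arbitrary places. -/
theorem exists_sequence {u v : V} {l M : ℕ} {D : ℤ} (h : Walk E u v l M D) :
    ∃ (p : ℕ → V) (c : ℕ → ℕ) (d : ℕ → ℤ), p 0 = u ∧ p l = v ∧ c 0 = 0 ∧ c l = M ∧ d 0 = 0 ∧
      d l = D ∧ ∀ i < l, ∃ m δ, E (p i) (p (i + 1)) m δ ∧ c (i + 1) = c i + m ∧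
        d (i + 1) = d i + δ := by
  induction h with
  | nil v => exact ⟨fun _ => v, fun _ => 0, fun _ => 0, by simp⟩
  | @cons v w x m δ l M D e _ ih =>
    obtain ⟨p, c, d, hp0, hpl, hc0, hcl, hd0, hdl, hstep⟩ := ih
    refine ⟨fun i => Nat.casesOn i v p, fun i => Nat.casesOn i 0 (fun i => m + c i),
      fun i => Nat.casesOn i 0 (fun i => δ + d i), rfl, hpl, rfl, by simp [hcl], rfl,
      by simp [hdl], ?_⟩
    rintro (_ | i) hi
    · exact ⟨m, δ, by simpa [hp0] using e, by simp [hc0], by simp [hd0]⟩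
    · obtain ⟨m', δ', he, h1, h2⟩ := hstep i (by omega)
      exact ⟨m', δ', he, by simp [h1, add_assoc], by simp [h2, add_assoc]⟩

/-- The inequality accompanies the walk because its output is written with truncated subtraction. -/
theorem of_sequence {p : ℕ → V} {c : ℕ → ℕ} {d : ℕ → ℤ} {l : ℕ}
    (h : ∀ i < l, ∃ m δ, E (p i) (p (i + 1)) m δ ∧ c (i + 1) = c i + m ∧ d (i + 1) = d i + δ)
    (i k : ℕ) (hk : i + k ≤ l) :
    c i ≤ c (i + k) ∧ Walk E (p i) (p (i + k)) k (c (i + k) - c i) (d (i + k) - d i) := by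
  induction k generalizing i with
  | zero => exact ⟨le_rfl, (Walk.nil (p i)).cast rfl (by simp) (by simp)⟩
  | succ k ih =>
    obtain ⟨m, δ, he, h1, h2⟩ := h i (by omega)
    obtain ⟨h3, h4⟩ := ih (i + 1) (by omega)
    have h5 : i + 1 + k = i + (k + 1) := by ring
    rw [h5] at h3 h4
    exact ⟨by omega, (Walk.cons he h4).cast rfl (by omega) (by rw [h2]; ring)⟩

/-- A walk that is at least as long as the number of vertices contains a short closed walk. -/
theorem exists_closed [Finite V] {u v : V} {l M : ℕ} {D : ℤ} (h : Walk E u v l M D)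
    (hl : Nat.card V ≤ l) :
    ∃ x l₁ l₂ l₃ M₁ M₂ M₃ D₁ D₂ D₃, Walk E u x l₁ M₁ D₁ ∧ Walk E x x l₂ M₂ D₂ ∧
      Walk E x v l₃ M₃ D₃ ∧ 0 < l₂ ∧ l₂ ≤ Nat.card V ∧ l = l₁ + l₂ + l₃ ∧ M = M₁ + M₂ + M₃ ∧
      D = D₁ + D₂ + D₃ := by
  obtain ⟨p, c, d, hp0, hpl, hc0, hcl, hd0, hdl, hstep⟩ := h.exists_sequence
  -- Pigeonhole among the first `Nat.card V + 1` positions only, so that the closed walk is short.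
  obtain ⟨i, j, hij, hpij⟩ : ∃ i j : Fin (Nat.card V + 1), i < j ∧ p i = p j := by
    have := Fintype.ofFinite V
    obtain ⟨i, j, hne, he⟩ := Fintype.exists_ne_map_eq_of_card_lt
      (fun i : Fin (Nat.card V + 1) => p i) (by simp [Nat.card_eq_fintype_card])
    rcases lt_or_gt_of_ne hne with h | h
    · exact ⟨i, j, h, he⟩
    · exact ⟨j, i, h, he.symm⟩
  obtain ⟨i, hi⟩ := i
  obtain ⟨j, hj⟩ := j
  simp only [Fin.mk_lt_mk] at hij hpij
  obtain ⟨k, rfl⟩ := Nat.exists_eq_add_of_lt hij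
  obtain ⟨k', rfl⟩ := Nat.exists_eq_add_of_le (show i + k + 1 ≤ l by omega)
  obtain ⟨a1, w1⟩ := of_sequence hstep 0 i (by omega)
  obtain ⟨a2, w2⟩ := of_sequence hstep i (k + 1) (by omega)
  obtain ⟨a3, w3⟩ := of_sequence hstep (i + k + 1) k' (by omega)
  rw [zero_add] at w1 a1
  rw [← add_assoc] at w2 a2
  rw [hp0] at w1
  rw [← hpij] at w2
  rw [← hpij, hpl] at w3
  exact ⟨p i, _, _, _, _, _, _, _, _, _, w1, w2, w3, by omega, by omega, by omega, by omega,
    by rw [← hdl, hd0]; ring⟩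

/-- If all short closed walks have ratio at most `P / q`, then so have all walks, up to an additive
constant. -/
theorem ratio_le [Finite V] {S : V → Prop} (hS : ∀ v w m δ, E v w m δ → S v → S w) {Δ : ℕ}
    (hΔ : ∀ v w m δ, E v w m δ → δ ≤ Δ) {P q : ℕ}
    (hPq : ∀ u l M D, S u → 0 < l → l ≤ Nat.card V → Walk E u u l M D → (q : ℤ) * D ≤ P * M)
    {u v : V} (hu : S u) {l M : ℕ} {D : ℤ} (h : Walk E u v l M D) :
    (q : ℤ) * D ≤ P * M + q * (Nat.card V * Δ) := by
  induction l using Nat.strong_induction_on generalizing M D with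
  | _ l ih =>
    -- A long walk contains a short closed walk, which obeys the ratio and can be removed; what is
    -- left in the end has fewer than `Nat.card V` edges and accounts for the additive constant.
    by_cases hl : Nat.card V ≤ l
    · obtain ⟨x, l₁, l₂, l₃, M₁, M₂, M₃, D₁, D₂, D₃, w1, w2, w3, h0, hc, rfl, rfl, rfl⟩ :=
        h.exists_closed hl
      have := ih (l₁ + l₃) (by omega) (w1.append w3)
      have := hPq x _ _ _ (w1.mem_of_closed hS hu) h0 hc w2
      push_cast at *
      linarith
    · have h1 := h.le_length_mul hΔ
      have h2 : (l : ℤ) * Δ ≤ Nat.card V * Δ := by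
        have : l ≤ Nat.card V := by omega
        gcongr
      have h3 : (q : ℤ) * D ≤ q * (Nat.card V * Δ) := by gcongr; linarith
      have : (0 : ℤ) ≤ P * M := by positivity
      linarith

/-- Only the sources of edges are tested, so the final vertex of an avoiding walk may satisfy `C`.
For a nonempty closed walk the base vertex is a source, which is what the application needs. -/
theorem avoid_or_visit (C : V → Prop) {u v : V} {l M : ℕ} {D : ℤ} (h : Walk E u v l M D) :
    Walk (fun v w m δ => E v w m δ ∧ ¬ C v) u v l M D ∨
      ∃ x l₁ l₂ M₁ M₂ D₁ D₂, C x ∧ Walk E u x l₁ M₁ D₁ ∧ Walk E x v l₂ M₂ D₂ ∧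
        l = l₁ + l₂ ∧ M = M₁ + M₂ ∧ D = D₁ + D₂ := by
  induction h with
  | nil => exact .inl (.nil _)
  | @cons v w x m δ l M D e h ih =>
    by_cases hv : C v
    · exact .inr ⟨v, 0, l + 1, 0, m + M, 0, δ + D, hv, .nil v, .cons e h, by simp, by simp, by simp⟩
    · obtain ih | ⟨y, l₁, l₂, M₁, M₂, D₁, D₂, hy, w1, w2, rfl, rfl, rfl⟩ := ih
      · exact .inl (.cons ⟨e, hv⟩ ih)
      · exact .inr ⟨y, _, l₂, _, M₂, _, D₂, hy, .cons e w1, w2, by ring, by ring, by ring⟩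

/-- A nonempty closed walk without output would be a cycle of a well-founded relation. -/
theorem output_pos (hwf : WellFounded (fun w v => ∃ δ, E v w 0 δ)) {u : V} {l M : ℕ} {D : ℤ}
    (h : Walk E u u l M D) (hl : 0 < l) : 0 < M := by
  have key : ∀ {v w : V} {l M : ℕ} {D : ℤ}, Walk E v w l M D → 0 < l → M = 0 →
      Relation.TransGen (fun w v => ∃ δ, E v w 0 δ) w v := by
    intro v w l M D h
    induction h with
    | nil => simp
    | @cons v w x m δ l M D e h ih =>
      intro _ h0
      obtain ⟨rfl, rfl⟩ : m = 0 ∧ M = 0 := by omega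
      rcases Nat.eq_zero_or_pos l with rfl | hl
      · cases h; exact .single ⟨_, e⟩
      · exact .tail (ih hl rfl) ⟨_, e⟩
  by_contra h0
  exact hwf.transGen.irrefl.irrefl u (key h hl (by omega))

end Walk

/-! ### Integer sequences with prescribed growth -/

/-- A nonincreasing sequence of integers that is bounded below is eventually constant. -/
theorem exists_forall_succ_eq_of_antitone_bddBelow {u : ℕ → ℤ} {N : ℕ} {B : ℤ}
    (hu : ∀ n ≥ N, u (n + 1) ≤ u n) (hB : ∀ n ≥ N, B ≤ u n) :
    ∃ N', ∀ n ≥ N', u (n + 1) = u n := by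
  obtain ⟨k, hk, hmin⟩ := exists_minimal_of_wellFoundedLT
    (fun k : ℕ => ∃ n ≥ N, u n = B + k) ⟨(u N - B).toNat, N, le_rfl, by
      have := hB N le_rfl; omega⟩
  obtain ⟨n₀, hn₀, hk⟩ := hk
  have hanti : ∀ n ≥ n₀, u n ≤ u n₀ := by
    intro n hn
    induction n, hn using Nat.le_induction with
    | base => rfl
    | succ n hn ih => exact (hu n (by omega)).trans ih
  have hge : ∀ n ≥ n₀, u n₀ ≤ u n := by
    intro n hn
    have h1 := hB n (by omega)
    have := hmin (y := (u n - B).toNat) ⟨n, by omega, by omega⟩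
    have h2 := hanti n hn
    have := this (by omega)
    omega
  exact ⟨n₀, fun n hn => le_antisymm (hu n (by omega))
    ((hanti n hn).trans (hge (n + 1) (by omega)))⟩

/-- A sequence that grows by at most `R` over `q` steps, and at least with slope `R / q`, eventually
grows by exactly `R` over `q` steps. -/
theorem exists_forall_add_eq_of_growth {f : ℕ → ℤ} {N q : ℕ} {R : ℤ} {a b K : ℕ} (hb : 0 < b)
    (hab : (a : ℤ) * q = b * R) (hle : ∀ n ≥ N, f (n + q) ≤ f n + R)
    (hge : ∀ n, (a : ℤ) * n ≤ b * f n + K) :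
    ∃ N', ∀ n ≥ N', f (n + q) = f n + R := by
  -- Sums over windows of length `q` turn steps of length `q` into steps of length one: `F n - R *
  -- n` is nonincreasing by `hle` and bounded below by `hge`, hence eventually constant.
  let F : ℕ → ℤ := fun n => ∑ r ∈ Finset.range q, f (n + r)
  have hF : ∀ n, F (n + 1) - F n = f (n + q) - f n := by
    intro n
    have h1 := Finset.sum_range_succ (fun r => f (n + r)) q
    have h2 := Finset.sum_range_succ' (fun r => f (n + r)) q
    have h3 : ∑ r ∈ Finset.range q, f (n + (r + 1)) = ∑ r ∈ Finset.range q, f (n + 1 + r) :=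
      Finset.sum_congr rfl fun r _ => by congr 1; ring
    simp only [h3, add_zero] at h2
    simp only [F]
    linarith
  have hFge : ∀ n : ℕ, (b : ℤ) * R * n ≤ b * F n + q * K := by
    intro n
    have : ∑ r ∈ Finset.range q, ((a : ℤ) * n) ≤ ∑ r ∈ Finset.range q, (b * f (n + r) + K) := by
      refine Finset.sum_le_sum fun r _ => ?_
      have := hge (n + r)
      push_cast at this
      have h0 : (0 : ℤ) ≤ a * r := by positivity
      linarith
    have hFn : ∑ r ∈ Finset.range q, (b : ℤ) * f (n + r) = b * F n := (Finset.mul_sum ..).symm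
    rw [Finset.sum_add_distrib, hFn] at this
    simp only [Finset.sum_const, Finset.card_range, nsmul_eq_mul] at this
    rw [← hab]
    linarith
  obtain ⟨N', hN'⟩ := exists_forall_succ_eq_of_antitone_bddBelow (u := fun n => F n - R * n)
    (N := N) (B := -(q * K)) (fun n hn => by
      have := hF n; have := hle n hn; push_cast; linarith) (fun n hn => by
      have h1 := hFge n
      have h2 : (1 : ℤ) ≤ b := by exact_mod_cast hb
      by_contra hlt
      push Not at hlt
      have h4 : F n - R * n + q * K ≤ -1 := by linarith
      have h3 : (b : ℤ) * (F n - R * n + q * K) ≤ b * (-1) := by gcongr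
      have h5 : (0 : ℤ) ≤ (b - 1) * (q * K) := by
        have : (0 : ℤ) ≤ b - 1 := by linarith
        positivity
      nlinarith)
  refine ⟨N', fun n hn => ?_⟩
  have := hN' n hn
  have := hF n
  push_cast at *
  linarith

/-! ### Counter systems: comparison of solutions and the value at infinity -/

/-- A finite graph with one counter.  An edge `edge v w m a d` requires that the counter is at least
`a`, decreases it by `a`, increases it by `d`, and outputs `m`.  At a node and counter value that
satisfy `zero`, the computation is blocked. -/
structure CounterSystem (V : Type*) where
  edge : V → V → ℕ → ℕ → ℕ → Prop
  zero : V → ℕ∞ → Prop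
  finite_edge : {e : V × V × ℕ × ℕ × ℕ | edge e.1 e.2.1 e.2.2.1 e.2.2.2.1 e.2.2.2.2}.Finite
  wf : WellFounded (fun w v => ∃ a d, edge v w 0 a d)
  zero_of_lt : ∀ {v w m a d} {n : ℕ∞}, edge v w m a d → n < a → zero v n
  zero_anti : ∀ {v} {n n' : ℕ∞}, n ≤ n' → zero v n' → zero v n
  zero_top : ∀ {v}, (∀ n : ℕ, zero v n) → zero v ⊤

namespace CounterSystem

variable {V : Type*} (A : CounterSystem V)

/-- The function `val` satisfies the equation for the minimal output at the node `v`. -/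
structure IsSolutionAt (val : V → ℕ∞ → ℕ∞) (v : V) : Prop where
  eq_zero : ∀ n, A.zero v n → val v n = 0
  le : ∀ {w m a d} {n : ℕ∞}, A.edge v w m a d → a ≤ n → val v n ≤ m + val w (n - a + d)
  attained : ∀ n, val v n = ⊤ ∨ A.zero v n ∨
    ∃ w m a d, A.edge v w m a d ∧ (a : ℕ∞) ≤ n ∧ val v n = m + val w (n - a + d)

variable {A} {val val' : V → ℕ∞ → ℕ∞}

/-- Induction on a natural number `k`, and for fixed `k` along edges without output. -/
theorem descent {P : ℕ → V → Prop}
    (h : ∀ k v, (∀ k' < k, ∀ w, P k' w) → (∀ w a d, A.edge v w 0 a d → P k w) → P k v)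
    (k : ℕ) (v : V) : P k v := by
  induction k using Nat.strong_induction_on generalizing v with
  | _ k ihk =>
    induction v using A.wf.induction with
    | _ v ihv => exact h k v ihk fun w a d he => ihv w ⟨a, d, he⟩

/-- A consequence of the induction principle `descent` for an edge with arbitrary output. -/
theorem descent_edge {P : ℕ → V → Prop} {k : ℕ} {v : V} (h : ∀ k' < k, ∀ w, P k' w)
    (h' : ∀ w a d, A.edge v w 0 a d → P k w) {w : V} {m a d k' : ℕ} (he : A.edge v w m a d)
    (hk : k = m + k') : P k' w := by
  rcases Nat.eq_zero_or_pos m with rfl | hm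
  · rw [zero_add] at hk
    exact hk ▸ h' w a d he
  · exact h k' (by omega) w

theorem exists_natCast_of_add_eq {x : ℕ∞} {m k : ℕ} (h : (m : ℕ∞) + x = k) :
    ∃ k' : ℕ, x = k' ∧ k = m + k' := by
  cases x with
  | top => simp at h
  | coe x => exact ⟨x, rfl, by exact_mod_cast h.symm⟩

/-- Follow an edge that attains the value of `val'`. Either the smaller counter is blocked and `val`
vanishes, or the same edge bounds `val` and the claim passes to its target. Two solutions at equal
arguments give uniqueness; one solution at two arguments gives monotonicity. -/
theorem le_of_isSolutionAt {S : V → Prop} (hS : ∀ {v w m a d}, A.edge v w m a d → S v → S w)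
    (h : ∀ v, S v → A.IsSolutionAt val v) (h' : ∀ v, S v → A.IsSolutionAt val' v) {v : V}
    (hv : S v) {n n' : ℕ∞} (hn : n ≤ n') : val v n ≤ val' v n' := by
  have key : ∀ (k : ℕ) (v : V), S v → ∀ n n' : ℕ∞, n ≤ n' → val' v n' = k →
      val v n ≤ val' v n' := by
    refine descent (A := A) fun k v ihk ihv hv n n' hn hk => ?_
    rcases (h' v hv).attained n' with ht | hz | ⟨w, m, a, d, he, ha, heq⟩
    · rw [ht]; exact le_top
    · rw [(h v hv).eq_zero n (A.zero_anti hn hz)]; exact zero_le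
    · rcases lt_or_ge n (a : ℕ∞) with hlt | hge
      · rw [(h v hv).eq_zero n (A.zero_of_lt he hlt)]; exact zero_le
      · obtain ⟨k', hk', hkk⟩ := exists_natCast_of_add_eq (heq.symm.trans hk)
        refine ((h v hv).le he hge).trans ?_
        rw [heq]
        gcongr
        exact descent_edge ihk ihv he hkk (hS he hv) _ _ (by gcongr) hk'
  cases hk : val' v n' with
  | top => exact le_top
  | coe k => exact hk ▸ key k v hv n n' hn hk

theorem eq_of_isSolutionAt {S : V → Prop} (hS : ∀ {v w m a d}, A.edge v w m a d → S v → S w)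
    (h : ∀ v, S v → A.IsSolutionAt val v) (h' : ∀ v, S v → A.IsSolutionAt val' v) {v : V}
    (hv : S v) (n : ℕ∞) : val v n = val' v n :=
  le_antisymm (le_of_isSolutionAt hS h h' hv le_rfl) (le_of_isSolutionAt hS h' h hv le_rfl)

section

variable (h : ∀ v, A.IsSolutionAt val v)
include h

theorem monotone (v : V) : Monotone (val v) := fun _ _ hn =>
  le_of_isSolutionAt (S := fun _ => True) (fun _ _ => trivial) (fun v _ => h v) (fun v _ => h v)
    trivial hn

/-- As there are finitely many edges, one edge is optimal for infinitely many counter values; its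
target is then bounded by what remains of `k`, and the induction goes on there. -/
theorem val_top_le (k : ℕ) (v : V) (hk : ∀ n : ℕ, val v n ≤ k) : val v ⊤ ≤ k := by
  revert hk
  refine descent (A := A) (P := fun k v => (∀ n : ℕ, val v n ≤ k) → val v ⊤ ≤ k)
    (fun k v ihk ihv hk => ?_) k v
  by_cases hz : ∀ n : ℕ, A.zero v n
  · rw [(h v).eq_zero _ (A.zero_top hz)]; exact zero_le
  push Not at hz
  obtain ⟨N, hN⟩ := hz
  have hcases : ∀ n ≥ N, ∃ e ∈ {e : V × V × ℕ × ℕ × ℕ |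
      A.edge e.1 e.2.1 e.2.2.1 e.2.2.2.1 e.2.2.2.2}, e.1 = v ∧ e.2.2.2.1 ≤ n ∧
        val v n = e.2.2.1 + val e.2.1 (n - e.2.2.2.1 + e.2.2.2.2 : ℕ) := by
    intro n hn
    rcases (h v).attained n with ht | hz | ⟨w, m, a, d, he, ha, heq⟩
    · have := hk n
      simp [ht] at this
    · exact absurd (A.zero_anti (by exact_mod_cast hn) hz) hN
    · exact ⟨(v, w, m, a, d), he, rfl, by exact_mod_cast ha, by push_cast; exact heq⟩
  -- Pigeonhole: if every edge were optimal only for small `n`, some large `n` would have no optimal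
  -- edge.
  obtain ⟨⟨v', w, m, a, d⟩, he, hfr⟩ : ∃ e ∈ {e : V × V × ℕ × ℕ × ℕ |
      A.edge e.1 e.2.1 e.2.2.1 e.2.2.2.1 e.2.2.2.2}, ∃ᶠ n : ℕ in Filter.atTop,
        e.1 = v ∧ e.2.2.2.1 ≤ n ∧
        val v n = e.2.2.1 + val e.2.1 (n - e.2.2.2.1 + e.2.2.2.2 : ℕ) := by
    by_contra hcon
    have := (Filter.eventually_all_finite A.finite_edge).2 fun e he =>
      Filter.not_frequently.1 fun hf => hcon ⟨e, he, hf⟩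
    obtain ⟨n, hn, hn'⟩ := (this.and (Filter.eventually_ge_atTop N)).exists
    obtain ⟨e, he, hp⟩ := hcases n hn'
    exact hn e he hp
  have he' : A.edge v' w m a d := he
  obtain ⟨n₁, hn₁⟩ := hfr.exists
  obtain rfl : v' = v := hn₁.1
  have hb : ∀ n : ℕ, (m : ℕ∞) + val w n ≤ k := by
    intro n
    obtain ⟨n', hge, -, -, heq⟩ := (Filter.frequently_atTop.1 hfr) (n + a)
    refine le_trans ?_ (hk n')
    rw [heq]
    gcongr
    refine monotone h w ?_
    exact_mod_cast (show n ≤ n' - a + d by omega)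
  have hmk : m ≤ k := by exact_mod_cast le_self_add.trans (hb 0)
  obtain ⟨k', rfl⟩ := Nat.exists_eq_add_of_le hmk
  have := descent_edge ihk ihv he' rfl fun n => by
    have := hb n
    push_cast at this
    exact (ENat.add_le_add_iff_left (ENat.natCast_ne_top m)).1 this
  calc val v' ⊤ ≤ m + val w (⊤ - a + d) := (h v').le he' le_top
    _ ≤ _ := by
      push_cast
      gcongr
      refine le_trans (monotone h w le_top) this

theorem val_top (v : V) : val v ⊤ = ⨆ n : ℕ, val v n := by
  refine le_antisymm ?_ (iSup_le fun n => monotone h v le_top)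
  cases hs : ⨆ n : ℕ, val v n with
  | top => exact le_top
  | coe k => exact val_top_le h k v fun n => hs ▸ le_iSup (fun n : ℕ => val v n) n

end

end CounterSystem

/-! ### Periodicity of the values of a counter system -/

namespace CounterSystem

variable {V : Type*} (A : CounterSystem V)

/-- Edges with their output and their net consumption. -/
def netEdge (v w : V) (m : ℕ) (δ : ℤ) : Prop := ∃ a d : ℕ, A.edge v w m a d ∧ δ = a - d

variable {A} {val : V → ℕ∞ → ℕ∞}

theorem wf_netEdge : WellFounded (fun w v => ∃ δ, A.netEdge v w 0 δ) :=
  Subrelation.wf (fun ⟨_, a, d, he, _⟩ => ⟨a, d, he⟩) A.wf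

theorem exists_bound : ∃ μ Δ : ℕ, ∀ v w m δ, A.netEdge v w m δ → m ≤ μ ∧ δ ≤ Δ := by
  obtain ⟨μ, hμ⟩ := (A.finite_edge.image fun e => e.2.2.1).bddAbove
  obtain ⟨Δ, hΔ⟩ := (A.finite_edge.image fun e => e.2.2.2.1).bddAbove
  refine ⟨μ, Δ, ?_⟩
  rintro v w m δ ⟨a, d, he, rfl⟩
  have h1 : m ≤ μ := hμ ⟨(v, w, m, a, d), he, rfl⟩
  have h2 : a ≤ Δ := hΔ ⟨(v, w, m, a, d), he, rfl⟩
  exact ⟨h1, by omega⟩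

section

variable (h : ∀ v, A.IsSolutionAt val v)
include h

/-- The counter need not stay nonnegative along the walk: where it is too small for an edge, the
computation is blocked and its value is 0, which only helps the upper bound. -/
theorem val_le_of_walk {v w : V} {l M : ℕ} {D : ℤ} (hw : Walk A.netEdge v w l M D) {n n' : ℕ}
    (hn : (n : ℤ) ≤ n' + D) : val v n ≤ M + val w n' := by
  induction hw generalizing n with
  | nil =>
    simp only [Nat.cast_zero, zero_add]
    exact monotone h _ (by exact_mod_cast (by omega : n ≤ n'))
  | @cons v w x m δ l M D e _ ih =>
    obtain ⟨a, d, he, rfl⟩ := e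
    rcases lt_or_ge n a with hlt | hge
    · rw [(h v).eq_zero n (A.zero_of_lt he (by exact_mod_cast hlt))]; exact zero_le
    · have h1 := (h v).le he (n := n) (by exact_mod_cast hge)
      have h2 := ih (n := n - a + d) (by push_cast [Nat.cast_sub hge]; linarith)
      refine h1.trans ?_
      push_cast at h2 ⊢
      rw [add_assoc]
      gcongr

/-- A walk that consumes more than is available gets blocked before its end, so no value at its
final vertex has to be added. -/
theorem val_le_of_lt_walk {v w : V} {l M : ℕ} {D : ℤ} (hw : Walk A.netEdge v w l M D) {n : ℕ}
    (hn : (n : ℤ) < D) : val v n ≤ M := by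
  induction hw generalizing n with
  | nil => omega
  | @cons v w x m δ l M D e _ ih =>
    obtain ⟨a, d, he, rfl⟩ := e
    rcases lt_or_ge n a with hlt | hge
    · rw [(h v).eq_zero n (A.zero_of_lt he (by exact_mod_cast hlt))]; exact zero_le
    · have h1 := (h v).le he (n := n) (by exact_mod_cast hge)
      have h2 := ih (n := n - a + d) (by push_cast [Nat.cast_sub hge]; linarith)
      refine h1.trans ?_
      push_cast at h2 ⊢
      gcongr

/-- The optimal choices are unrolled until the value is used up; the same induction as for
uniqueness ensures that this ends. -/
theorem exists_optimal_walk (k : ℕ) (v : V) (n : ℕ) (hk : val v n = k) :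
    ∃ w l D, ∃ n' : ℕ, Walk A.netEdge v w l k D ∧ (n : ℤ) = n' + D ∧ val w n' = 0 := by
  revert n
  refine descent (A := A) (P := fun k v => ∀ n : ℕ, val v n = k → ∃ w l D, ∃ n' : ℕ,
    Walk A.netEdge v w l k D ∧ (n : ℤ) = n' + D ∧ val w n' = 0) (fun k v ihk ihv n hk => ?_) k v
  rcases (h v).attained n with ht | hz | ⟨w, m, a, d, he, ha, heq⟩
  · simp [ht] at hk
  · have h0 := (h v).eq_zero n hz
    obtain rfl : k = 0 := by rw [h0] at hk; exact_mod_cast hk.symm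
    exact ⟨v, 0, 0, n, .nil v, by simp, h0⟩
  · obtain ⟨k', hk', rfl⟩ := exists_natCast_of_add_eq (heq.symm.trans hk)
    have ha' : a ≤ n := by exact_mod_cast ha
    obtain ⟨x, l, D, n', hw, hn, h0⟩ := descent_edge ihk ihv he rfl (n - a + d)
      (by push_cast; exact hk')
    refine ⟨x, l + 1, (a - d : ℤ) + D, n', .cons ⟨a, d, he, rfl⟩ hw, ?_, h0⟩
    push_cast [Nat.cast_sub ha'] at hn
    linarith

/-- An unbounded solution with finite values is eventually linear up to periodicity. -/
theorem exists_quasi_linear [Finite V] (v₀ : V) (f : ℕ → ℕ) (hf : ∀ n : ℕ, val v₀ n = f n)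
    (hunb : ∀ K, ∃ n, K < f n) :
    ∃ N q R : ℕ, 0 < q ∧ ∀ n ≥ N, f (n + q) = f n + R := by
  classical
  obtain ⟨μ, Δ, hbd⟩ := exists_bound (A := A)
  have hΔ : ∀ v w m δ, A.netEdge v w m δ → δ ≤ Δ := fun v w m δ he => (hbd v w m δ he).2
  have hμ : ∀ v w m δ, A.netEdge v w m δ → m ≤ μ := fun v w m δ he => (hbd v w m δ he).1
  let S : V → Prop := fun u => ∃ l M D, Walk A.netEdge v₀ u l M D
  have hS : ∀ v w m δ, A.netEdge v w m δ → S v → S w := by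
    rintro v w m δ he ⟨l, M, D, hw⟩
    exact ⟨_, _, _, hw.append (.cons he (.nil w))⟩
  have hS₀ : S v₀ := ⟨0, 0, 0, .nil v₀⟩
  have hmono : ∀ u, Monotone fun n : ℕ => val u n := fun u n n' hn =>
    monotone h u (by exact_mod_cast hn)
  -- the counter values at which reachable nodes have value zero are bounded
  obtain ⟨a₀, ha₀⟩ : ∃ a₀ : ℕ, ∀ u, S u → ∀ n : ℕ, val u n = 0 → n < a₀ := by
    have : ∀ u, ∃ a₀ : ℕ, S u → ∀ n : ℕ, val u n = 0 → n < a₀ := by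
      intro u
      by_contra hcon
      push Not at hcon
      obtain ⟨⟨l, M, D, hw⟩, -⟩ := hcon 0
      -- Zeros at arbitrarily large counter values spread downwards by monotonicity; then `f` would
      -- be bounded by the output `M` of a walk to `u`.
      have hz : ∀ n : ℕ, val u n = 0 := by
        intro n
        obtain ⟨-, n', h0, hn⟩ := hcon n
        exact le_antisymm (h0 ▸ hmono u hn) zero_le
      obtain ⟨n, hn⟩ := hunb M
      have := val_le_of_walk h hw (n := n) (n' := (n - D).toNat) (by omega)
      rw [hz, hf, add_zero] at this
      have : f n ≤ M := by exact_mod_cast this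
      omega
    choose a ha using this
    obtain ⟨B, hB⟩ := (Set.finite_range a).bddAbove
    exact ⟨B, fun u hu n hn => (ha u hu n hn).trans_le (hB ⟨u, rfl⟩)⟩
  have hopt : ∀ n : ℕ, ∃ w l D, ∃ n' < a₀, Walk A.netEdge v₀ w l (f n) D ∧ (n : ℤ) = n' + D ∧
      val w n' = 0 := by
    intro n
    obtain ⟨w, l, D, n', hw, hn, h0⟩ := exists_optimal_walk h (f n) v₀ n (hf n)
    exact ⟨w, l, D, n', ha₀ w ⟨_, _, _, hw⟩ n' h0, hw, hn, h0⟩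
  -- the ratios of short closed walks
  let Q : ℕ := Nat.card V * μ
  let C : Set (ℕ × ℕ) := {z | 0 < z.2 ∧ ∃ u l, S u ∧ 0 < l ∧ l ≤ Nat.card V ∧
    Walk A.netEdge u u l z.1 z.2}
  have hshort : ∀ {u l M D}, 0 < l → l ≤ Nat.card V → Walk A.netEdge u u l M D →
      0 < M ∧ M ≤ Q ∧ D ≤ (Nat.card V * Δ : ℕ) := by
    intro u l M D hl hl' hw
    refine ⟨hw.output_pos wf_netEdge hl, (hw.output_le_length_mul hμ).trans ?_,
      (hw.le_length_mul hΔ).trans ?_⟩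
    · exact Nat.mul_le_mul_right μ hl'
    · push_cast; gcongr
  have hCfin : C.Finite := by
    refine ((Set.finite_Iic Q).prod (Set.finite_Iic (Nat.card V * Δ))).subset ?_
    rintro ⟨M, D⟩ ⟨hD, u, l, hu, hl, hl', hw⟩
    obtain ⟨-, h1, h2⟩ := hshort hl hl' hw
    exact ⟨h1, by simpa using (by exact_mod_cast h2 : D ≤ Nat.card V * Δ)⟩
  -- Without short closed walks of positive net consumption, every walk from `v₀` would consume at
  -- most `Nat.card V * Δ`. An optimal walk from this argument consumes more, as it ends below `a₀`.
  have hCne : C.Nonempty := by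
    by_contra hemp
    rw [Set.not_nonempty_iff_eq_empty] at hemp
    obtain ⟨w, l, D, n', hn', hw, hn, -⟩ := hopt (a₀ + Nat.card V * Δ)
    have := hw.ratio_le hS hΔ (P := 0) (q := 1) (fun u l M D hu hl hl' hw => by
      by_contra hlt
      push_cast at hlt
      have : (M, D.toNat) ∈ C := ⟨by simp; omega, u, l, hu, hl, hl', by
        have : ((D.toNat : ℕ) : ℤ) = D := by omega
        simpa [this] using hw⟩
      simp [hemp] at this) hS₀
    push_cast at this hn
    linarith [(by exact_mod_cast hn' : (n' : ℤ) < a₀)]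
  obtain ⟨⟨M₀, D₀⟩, ⟨hD₀, u₀, l₀, ⟨l₁, M₁, D₁, hw₁⟩, hl₀, hl₀', hw₀⟩, hmax⟩ :=
    Set.exists_max_image C (fun z => (z.2 : ℚ) / z.1) hCfin hCne
  simp only at hD₀ hw₀ hmax
  obtain ⟨hM₀, hM₀Q, -⟩ := hshort hl₀ hl₀' hw₀
  have hratio : ∀ u l M D, S u → 0 < l → l ≤ Nat.card V → Walk A.netEdge u u l M D →
      (M₀ : ℤ) * D ≤ D₀ * M := by
    intro u l M D hu hl hl' hw
    obtain ⟨hM, -, -⟩ := hshort hl hl' hw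
    rcases le_or_gt D 0 with hD | hD
    · have h1 : (M₀ : ℤ) * D ≤ 0 := mul_nonpos_of_nonneg_of_nonpos (by positivity) hD
      have h2 : (0 : ℤ) ≤ D₀ * M := by positivity
      linarith
    · obtain ⟨D, rfl⟩ := Int.eq_ofNat_of_zero_le hD.le
      have := hmax (M, D) ⟨by simpa using hD, u, l, hu, hl, hl', hw⟩
      simp only at this
      rw [div_le_div_iff₀ (by exact_mod_cast hM) (by exact_mod_cast hM₀)] at this
      have : D * M₀ ≤ D₀ * M := by exact_mod_cast this
      rw [mul_comm]
      exact_mod_cast this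
  have hQ : 0 < Q := by omega
  -- the slope of `f`
  have hlower : ∀ n : ℕ, (M₀ : ℤ) * n ≤ D₀ * f n + (M₀ * (Nat.card V * Δ + a₀) : ℕ) := by
    intro n
    obtain ⟨w, l, D, n', hn', hw, hn, -⟩ := hopt n
    have := hw.ratio_le hS hΔ hratio hS₀
    rw [hn]
    have h1 : (M₀ : ℤ) * n' ≤ M₀ * a₀ := by gcongr
    push_cast
    linarith
  obtain ⟨K₁, hupper⟩ : ∃ K₁ : ℤ, ∀ n : ℕ, (D₀ : ℤ) * f n ≤ M₀ * n + K₁ := by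
    refine ⟨D₀ * M₁ + M₀ * (D₁.natAbs + D₀), fun n => ?_⟩
    -- Just enough turns around the best closed walk to consume more than `n`, whatever the sign of
    -- `D₁`.
    let t := (n + D₁.natAbs) / D₀ + 1
    have ht : n + D₁.natAbs < D₀ * t := Nat.lt_mul_div_succ _ hD₀
    have ht' : D₀ * t ≤ n + D₁.natAbs + D₀ := by
      have := Nat.mul_div_le (n + D₁.natAbs) D₀
      simp only [t, mul_add]; omega
    have := val_le_of_lt_walk h (hw₁.append (hw₀.iterate t)) (n := n) (by
      have : (n : ℤ) + D₁.natAbs < D₀ * t := by exact_mod_cast ht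
      have h2 : (t : ℤ) * D₀ = D₀ * t := mul_comm _ _
      omega)
    rw [hf] at this
    have h1 : f n ≤ M₁ + t * M₀ := by exact_mod_cast this
    have h2 : D₀ * f n ≤ D₀ * M₁ + M₀ * (n + D₁.natAbs + D₀) := by
      calc D₀ * f n ≤ D₀ * (M₁ + t * M₀) := by gcongr
        _ = D₀ * M₁ + M₀ * (D₀ * t) := by ring
        _ ≤ _ := by gcongr
    have h3 : (D₀ : ℤ) * f n ≤ D₀ * M₁ + M₀ * (n + D₁.natAbs + D₀) := by exact_mod_cast h2
    linarith
  -- for large arguments, optimal walks visit nodes with a closed walk of maximal ratio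
  let crit : V → Prop := fun u => ∃ l M D, 0 < l ∧ l ≤ Nat.card V ∧ Walk A.netEdge u u l M D ∧
    (M₀ : ℤ) * D = D₀ * M
  obtain ⟨N, hN⟩ : ∃ N, ∀ n ≥ N, ∀ w l D, ∀ n' < a₀, Walk A.netEdge v₀ w l (f n) D →
      (n : ℤ) = n' + D → ¬ Walk (fun v w m δ => A.netEdge v w m δ ∧ ¬ crit v) v₀ w l (f n) D := by
    -- Away from critical nodes the integer inequality for the ratio is strict. As outputs of short
    -- closed walks are at most `Q`, the gap of one becomes a uniformly smaller ratio.
    have hslope : ∀ u l M D, S u → 0 < l → l ≤ Nat.card V →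
        Walk (fun v w m δ => A.netEdge v w m δ ∧ ¬ crit v) u u l M D →
        ((Q * M₀ : ℕ) : ℤ) * D ≤ ((Q * D₀ - 1 : ℕ) : ℤ) * M := by
      intro u l M D hu hl hl' hw
      have hw' : Walk A.netEdge u u l M D := hw.mono fun _ _ _ _ he => he.1
      have hnc : ¬ crit u := by
        cases hw with
        | nil => omega
        | cons e _ => exact e.2
      have h1 := hratio u l M D hu hl hl' hw'
      have h2 : (M₀ : ℤ) * D ≠ D₀ * M := fun heq => hnc ⟨l, M, D, hl, hl', hw', heq⟩
      have h3 : (M₀ : ℤ) * D + 1 ≤ D₀ * M := lt_of_le_of_ne h1 h2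
      obtain ⟨-, hMQ, -⟩ := hshort hl hl' hw'
      have h4 : (Q : ℤ) * (M₀ * D + 1) ≤ Q * (D₀ * M) := by gcongr
      have h5 : (M : ℤ) ≤ Q := by exact_mod_cast hMQ
      have h6 : 1 ≤ Q * D₀ := Nat.mul_pos hQ hD₀
      push_cast [Nat.cast_sub h6]
      linarith
    -- Eliminating `D` and `f n` from the smaller ratio and `hupper` bounds `M₀ * n`, hence `n`, by
    -- the expression in parentheses.
    refine ⟨(M₀ * Q * a₀ * D₀ + (Q * D₀ - 1) * K₁ + D₀ * (Q * M₀) * (Nat.card V * Δ) : ℤ).toNat + 1,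
      fun n hn w l D n' hn' hw hnD hav => ?_⟩
    have h1 := hav.ratio_le (fun v w m δ he hv => hS v w m δ he.1 hv)
      (fun v w m δ he => hΔ v w m δ he.1) hslope hS₀
    have h2 := hupper n
    have h6 : 1 ≤ Q * D₀ := Nat.mul_pos hQ hD₀
    push_cast [Nat.cast_sub h6] at h1
    have h7 : (0 : ℤ) ≤ Q * D₀ - 1 := by
      have : (1 : ℤ) ≤ Q * D₀ := by exact_mod_cast h6
      linarith
    have h3 : ((Q * D₀ - 1 : ℤ)) * (D₀ * f n) ≤ (Q * D₀ - 1) * (M₀ * n + K₁) := by gcongr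
    have h4 : (D₀ : ℤ) * (Q * M₀ * D) ≤
        D₀ * ((Q * D₀ - 1) * f n + Q * M₀ * (Nat.card V * Δ)) := by gcongr
    have h5 : (n : ℤ) - a₀ ≤ D := by omega
    have h8 : (D₀ : ℤ) * (Q * M₀ * (n - a₀)) ≤ D₀ * (Q * M₀ * D) := by gcongr
    have h9 : (n : ℤ) ≤ M₀ * n := by
      have : (1 : ℤ) ≤ M₀ := by exact_mod_cast hM₀
      nlinarith
    have h10 : (M₀ * n : ℤ) ≤
        M₀ * Q * a₀ * D₀ + (Q * D₀ - 1) * K₁ + D₀ * (Q * M₀) * (Nat.card V * Δ) := by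
      linarith
    omega
  -- pumping
  let R := Q.factorial
  obtain ⟨r, hr⟩ : M₀ ∣ R := Nat.dvd_factorial hM₀ hM₀Q
  -- `R` is a multiple of the output of every short closed walk. So some number of turns around the
  -- critical closed walk outputs exactly `R` and, the ratio being the same, consumes exactly `D₀ *
  -- r`, independently of the walk chosen.
  have hpump : ∀ n ≥ N, f (n + D₀ * r) ≤ f n + R := by
    intro n hn
    obtain ⟨w, l, D, n', hn', hw, hnD, h0⟩ := hopt n
    rcases hw.avoid_or_visit crit with hav | ⟨x, l₁, l₂, M₁, M₂, D₁, D₂, hx, w1, w2, -, hM, hD⟩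
    · exact absurd hav (hN n hn w l D n' hn' hw hnD)
    · obtain ⟨lc, Mc, Dc, hlc, hlc', wc, hcr⟩ := hx
      obtain ⟨hMc, hMcQ, -⟩ := hshort hlc hlc' wc
      obtain ⟨s, hs⟩ : Mc ∣ R := Nat.dvd_factorial hMc hMcQ
      have hsD : (s : ℤ) * Dc = D₀ * r := by
        have h1 : (M₀ : ℤ) * r = Mc * s := by exact_mod_cast hr.symm.trans hs
        have h2 : (M₀ : ℤ) ≠ 0 := by exact_mod_cast hM₀.ne'
        apply mul_left_cancel₀ h2
        linear_combination (s : ℤ) * hcr - D₀ * h1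
      have := val_le_of_walk h ((w1.append (wc.iterate s)).append w2) (n := n + D₀ * r) (n' := n')
        (by push_cast; linarith)
      rw [h0, hf, add_zero] at this
      have : f (n + D₀ * r) ≤ M₁ + s * Mc + M₂ := by exact_mod_cast this
      rw [hM, hs]
      linarith
  obtain ⟨N', hN'⟩ := exists_forall_add_eq_of_growth (f := fun n => (f n : ℤ)) (N := N)
    (q := D₀ * r) (R := R) hD₀ (by rw [hr]; push_cast; ring)
    (fun n hn => by exact_mod_cast hpump n hn) hlower
  refine ⟨N', D₀ * r, R, Nat.mul_pos hD₀ ?_, fun n hn => by exact_mod_cast hN' n hn⟩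
  rcases Nat.eq_zero_or_pos r with rfl | hr'
  · exact absurd hr (by simp [R, Nat.factorial_ne_zero])
  · exact hr'

/-- Besides the finite unbounded case, bounded values are eventually constant by monotonicity, and
once a value is infinite all later ones are; there the derivative is `⊤ - ⊤` throughout. -/
theorem periodicallyIncreasing₁ [Finite V] (v : V) : PeriodicallyIncreasing₁ (val v) := by
  have hmono : Monotone fun n : ℕ => val v n := fun n n' hn =>
    monotone h v (by exact_mod_cast hn)
  refine ⟨fun n => hmono n.le_succ, ?_, val_top h v⟩
  by_cases hfin : ∀ n : ℕ, val v n ≠ ⊤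
  · choose f hf using fun n => ENat.ne_top_iff_exists.1 (hfin n)
    have hf' : Monotone f := fun n n' hn => by
      have := hmono hn
      simp only [← hf] at this
      exact_mod_cast this
    obtain ⟨N, q, R, hq, hper⟩ : ∃ N q R : ℕ, 0 < q ∧ ∀ n ≥ N, f (n + q) = f n + R := by
      by_cases hunb : ∀ K, ∃ n, K < f n
      · exact exists_quasi_linear h v f (fun n => (hf n).symm) hunb
      · push Not at hunb
        obtain ⟨K, hK⟩ := hunb
        have hfinite : (Set.range f).Finite := (Set.finite_Iic K).subset (by
          rintro _ ⟨n, rfl⟩; exact hK n)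
        obtain ⟨_, ⟨N, rfl⟩, hN⟩ := Set.exists_max_image _ id hfinite (Set.range_nonempty f)
        refine ⟨N, 1, 0, one_pos, fun n hn => ?_⟩
        have h1 := hN _ ⟨n + 1, rfl⟩
        have h2 := hf' hn
        have h3 := hf' n.le_succ
        simp only [id] at h1
        simp only [Nat.succ_eq_add_one] at h3
        omega
    refine ⟨N, q, hq, fun n hn => ?_⟩
    simp only [← hf]
    have h1 := hper n hn
    have h2 := hper (n + 1) (by omega)
    have h3 : n + q + 1 = n + 1 + q := by ring
    rw [h3, h1, h2]
    norm_cast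
    omega
  · push Not at hfin
    obtain ⟨N, hN⟩ := hfin
    have : ∀ n ≥ N, val v n = ⊤ := fun n hn => top_le_iff.1 (hN ▸ hmono hn)
    refine ⟨N, 1, one_pos, fun n hn => ?_⟩
    rw [this _ hn, this (n + 1) (by omega), this (n + 1 + 1) (by omega)]

end

end CounterSystem

/-! ### Attained infima and the equations for single rules -/

theorem ENat.exists_mem_biInf_eq {α : Type*} {s : Set α} (hs : s.Nonempty) (g : α → ℕ∞) :
    ∃ a ∈ s, ⨅ b ∈ s, g b = g a := by
  rw [← sInf_image]
  obtain ⟨a, ha, h⟩ := csInf_mem (hs.image g)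
  exact ⟨a, ha, h.symm⟩

theorem ENat.exists_iInf_eq {α : Type*} [Nonempty α] (g : α → ℕ∞) : ∃ a, ⨅ b, g b = g a := by
  obtain ⟨a, h⟩ := csInf_mem (Set.range_nonempty g)
  exact ⟨a, h.symm⟩

namespace FinTerm

variable {S : StreamSig.{u}} {Y : Type}

theorem exists_eq_var_of_not_isApp {s : FinTerm S Y} (h : ¬ s.IsApp) : ∃ us y, s = var us y := by
  cases s with
  | var us y => exact ⟨us, y, rfl⟩
  | app => exact absurd trivial h

/-- The total number of stream elements in front of the arguments of the root. -/
def argsPrefixLength : FinTerm S Y → ℕ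
  | var _ _ => 0
  | app _ _ args _ => ∑ j, (args j).prefixLength

end FinTerm

namespace StreamSpec

variable {T : StreamSpec.{u}}

/-- Exhaustiveness is applied to constant streams. Nonemptiness is what makes the infima over rules
attained. -/
theorem rules_nonempty (f : T.SSym) : (T.rules f).Nonempty := by
  obtain ⟨v, hv⟩ := T.data_nonempty
  obtain ⟨ρ, hρ, -⟩ := T.exhaustive_stream f (fun _ _ => v) (fun _ => v) (fun _ _ => hv)
    fun _ => hv
  exact ⟨ρ, hρ⟩

theorem FriendlyNesting.of_occurs {f g : T.SSym} (hf : T.FriendlyNesting f)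
    {ρ : StreamRule T.toStreamSig f} (hρ : ρ ∈ T.rules f) (hg : ρ.rhs.Occurs g) :
    T.FriendlyNesting g :=
  fun ρ' γ hγ => hf ⟨ρ, hρ⟩ γ (.head (show T.Depends ⟨f, ρ, hρ⟩ ⟨g, ρ'⟩ from hg) hγ)

theorem Flat.of_occurs {f g : T.SSym} (hf : T.Flat f)
    {ρ : StreamRule T.toStreamSig f} (hρ : ρ ∈ T.rules f) (hg : ρ.rhs.Occurs g) : T.Flat g :=
  fun ρ' γ hγ => hf ⟨ρ, hρ⟩ γ (.head (show T.Depends ⟨f, ρ, hρ⟩ ⟨g, ρ'⟩ from hg) hγ)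

namespace Valuation

variable (X : T.Valuation) {f : T.SSym} {ρ : StreamRule T.toStreamSig f}

theorem starRule_of_nested (h : ρ.rhs.Nested) : X.starRule ρ = ⊤ := if_pos h

theorem starRule_var {cs j} (h : ρ.rhs = .var cs j) : X.starRule ρ = ⊤ := by
  simp [starRule, h]

theorem starRule_app {cs g args vs} (h : ρ.rhs = .app cs g args vs) (hn : ¬ ρ.rhs.Nested) :
    X.starRule ρ = cs.length + X.star g := by
  rw [starRule, if_neg hn, h]

theorem argRule_of_nested (h : ρ.rhs.Nested) (i n) : X.argRule ρ i n = n := if_pos h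

theorem argRule_of_lt (h : ¬ ρ.rhs.Nested) {i} {n : ℕ∞} (hn : n < (ρ.pats i).length) :
    X.argRule ρ i n = 0 := by
  rw [argRule, if_neg h, if_pos hn]

open Classical in
theorem argRule_var {cs j} (h : ρ.rhs = .var cs j) {i} {n : ℕ∞}
    (hn : ((ρ.pats i).length : ℕ∞) ≤ n) :
    X.argRule ρ i n = cs.length + if i = j then n - (ρ.pats i).length else ⊤ := by
  have hnn : ¬ ρ.rhs.Nested := by simp [h, FinTerm.Nested]
  rw [argRule, if_neg hnn, if_neg hn.not_gt, h]

open Classical in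
theorem argRule_app {cs g args vs} (h : ρ.rhs = .app cs g args vs) (hnn : ¬ ρ.rhs.Nested) {i}
    {n : ℕ∞} (hn : ((ρ.pats i).length : ℕ∞) ≤ n) :
    X.argRule ρ i n = cs.length + ⨅ j, match args j with
        | .var ds p => if p = i then X.arg g j (n - (ρ.pats i).length + ds.length) else ⊤
        | .app _ _ _ _ => ⊤ := by
  rw [argRule, if_neg hnn, if_neg hn.not_gt, h]

/-- The equations of the system that belong to the symbol `f`. -/
structure SolvesAt (f : T.SSym) : Prop where
  fn : ∀ n, X.fn f n = min (X.star f) (⨅ i, X.arg f i (n i))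
  star_of : T.WeaklyGuarded f → X.star f = ⨅ ρ ∈ T.rules f, X.starRule ρ
  star_of_not : ¬ T.WeaklyGuarded f → X.star f = 0
  arg_of : T.WeaklyGuarded f → ∀ i n, X.arg f i n = ⨅ ρ ∈ T.rules f, X.argRule ρ i n
  arg_of_not : ¬ T.WeaklyGuarded f → ∀ i n, X.arg f i n = 0

variable {X}

theorem IsSolution.solvesAt (h : X.IsSolution) (hf : T.FriendlyNesting f) : X.SolvesAt f where
  fn := (h f hf).1
  star_of hg := by rw [(h f hf).2.1, if_pos hg]
  star_of_not hg := by rw [(h f hf).2.1, if_neg hg]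
  arg_of hg i n := by rw [(h f hf).2.2, if_pos hg]
  arg_of_not hg i n := by rw [(h f hf).2.2, if_neg hg]

theorem isSolution_of_solvesAt (h : ∀ f, X.SolvesAt f) : X.IsSolution := by
  intro f _
  refine ⟨(h f).fn, ?_, fun i n => ?_⟩
  · split_ifs with hg
    exacts [(h f).star_of hg, (h f).star_of_not hg]
  · split_ifs with hg
    exacts [(h f).arg_of hg i n, (h f).arg_of_not hg i n]

end Valuation

/-! ### Existence of a solution -/

/-- The valuation with given values for `X_{f,⋆}` and `X_{f,i}`. -/
noncomputable def valuationOf (p : (T.SSym → ℕ∞) × (∀ f : T.SSym, Fin (T.sAr f) → ℕ∞ → ℕ∞)) :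
    T.Valuation where
  fn f n := min (p.1 f) (⨅ i, p.2 f i (n i))
  star := p.1
  arg := p.2

theorem starRule_mono {p q : (T.SSym → ℕ∞) × (∀ f : T.SSym, Fin (T.sAr f) → ℕ∞ → ℕ∞)}
    (h : p ≤ q) {f : T.SSym} (ρ : StreamRule T.toStreamSig f) :
    (valuationOf p).starRule ρ ≤ (valuationOf q).starRule ρ := by
  unfold Valuation.starRule
  split_ifs
  · exact le_rfl
  · cases ρ.rhs with
    | var => exact le_rfl
    | app cs g args vs => exact add_le_add_right (h.1 g) _

theorem argRule_mono {p q : (T.SSym → ℕ∞) × (∀ f : T.SSym, Fin (T.sAr f) → ℕ∞ → ℕ∞)}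
    (h : p ≤ q) {f : T.SSym} (ρ : StreamRule T.toStreamSig f) (i n) :
    (valuationOf p).argRule ρ i n ≤ (valuationOf q).argRule ρ i n := by
  unfold Valuation.argRule
  split_ifs
  · exact le_rfl
  · exact le_rfl
  · cases ρ.rhs with
    | var => exact le_rfl
    | app cs g args vs =>
      refine add_le_add_right (iInf_mono fun j => ?_) _
      cases args j with
      | app => exact le_rfl
      | var ds k =>
        simp only
        split_ifs
        · exact h.2 g j _
        · exact le_rfl

open Classical in
/-- The operator whose fixed points are the solutions of the system. -/
noncomputable def systemOperator (T : StreamSpec.{u}) :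
    ((T.SSym → ℕ∞) × (∀ f : T.SSym, Fin (T.sAr f) → ℕ∞ → ℕ∞)) →o
      ((T.SSym → ℕ∞) × (∀ f : T.SSym, Fin (T.sAr f) → ℕ∞ → ℕ∞)) where
  toFun p :=
    (fun f => if T.WeaklyGuarded f then ⨅ ρ ∈ T.rules f, (valuationOf p).starRule ρ else 0,
      fun f i n =>
        if T.WeaklyGuarded f then ⨅ ρ ∈ T.rules f, (valuationOf p).argRule ρ i n else 0)
  monotone' p q h := by
    refine ⟨fun f => ?_, fun f i n => ?_⟩
    · simp only
      split_ifs
      · exact iInf₂_mono fun ρ _ => starRule_mono h ρ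
      · exact le_rfl
    · simp only
      split_ifs
      · exact iInf₂_mono fun ρ _ => argRule_mono h ρ i n
      · exact le_rfl

variable (T) in
/-- A solution of all equations, also of those for symbols that are not friendly nesting. -/
theorem exists_solvesAt : ∃ X : T.Valuation, ∀ f, X.SolvesAt f := by
  -- Knaster–Tarski: the unknowns take values in a complete lattice.
  have h := T.systemOperator.map_lfp
  have h1 := congr_arg Prod.fst h
  have h2 := congr_arg Prod.snd h
  refine ⟨valuationOf T.systemOperator.lfp, fun f => ⟨fun _ => rfl, fun hg => ?_, fun hg => ?_,
    fun hg i n => ?_, fun hg i n => ?_⟩⟩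
  · exact (congr_fun h1 f).symm.trans (if_pos hg)
  · exact (congr_fun h1 f).symm.trans (if_neg hg)
  · exact (congr_fun (congr_fun (congr_fun h2 f) i) n).symm.trans (if_pos hg)
  · exact (congr_fun (congr_fun (congr_fun h2 f) i) n).symm.trans (if_neg hg)

/-! ### The system as a counter system -/

variable (T) in
/-- The node `none` stands for the identity function. -/
abbrev Node : Type u := Option (T.SSym ⊕ (Σ f : T.SSym, Fin (T.sAr f)))

/-- The dependencies between the unknowns that arise from a rule. -/
inductive RuleEdge {f : T.SSym} (ρ : StreamRule T.toStreamSig f) :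
    T.Node → T.Node → ℕ → ℕ → ℕ → Prop
  | star {cs g args vs} (h : ρ.rhs = .app cs g args vs) (hn : ¬ ρ.rhs.Nested) :
      RuleEdge ρ (some (.inl f)) (some (.inl g)) cs.length 0 0
  | nested (h : ρ.rhs.Nested) (i) : RuleEdge ρ (some (.inr ⟨f, i⟩)) none 0 0 0
  | var {cs i} (h : ρ.rhs = .var cs i) :
      RuleEdge ρ (some (.inr ⟨f, i⟩)) none cs.length (ρ.pats i).length 0
  | arg {cs g args vs ds i} (h : ρ.rhs = .app cs g args vs) (hn : ¬ ρ.rhs.Nested) (j)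
      (hj : args j = .var ds i) :
      RuleEdge ρ (some (.inr ⟨f, i⟩)) (some (.inr ⟨g, j⟩)) cs.length (ρ.pats i).length ds.length

/-- The loop at `none` takes one element and outputs one, so that the value there is the identity.
Unguarded symbols have no outgoing edges. -/
def NodeEdge (v w : T.Node) (m a d : ℕ) : Prop :=
  (v = none ∧ w = none ∧ m = 1 ∧ a = 1 ∧ d = 0) ∨
    ∃ f, T.WeaklyGuarded f ∧ ∃ ρ ∈ T.rules f, RuleEdge ρ v w m a d

/-- Nesting rules never block, since their contribution is the identity function. -/
def NodeZero : T.Node → ℕ∞ → Prop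
  | none, n => n < 1
  | some (.inl f), _ => ¬ T.WeaklyGuarded f
  | some (.inr ⟨f, i⟩), n => ¬ T.WeaklyGuarded f ∨
      ∃ ρ ∈ T.rules f, ¬ ρ.rhs.Nested ∧ n < (ρ.pats i).length

/-- A crude common bound for all weights; with finitely many rules it makes the set of edges finite.
-/
theorem RuleEdge.le_size {f : T.SSym} {ρ : StreamRule T.toStreamSig f} {v w : T.Node} {m a d : ℕ}
    (h : RuleEdge ρ v w m a d) :
    max m (max a d) ≤
      ρ.rhs.prefixLength + ∑ i, (ρ.pats i).length + ρ.rhs.argsPrefixLength := by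
  have hs : ∀ i, (ρ.pats i).length ≤ ∑ i, (ρ.pats i).length := fun i =>
    Finset.single_le_sum (f := fun i => (ρ.pats i).length) (fun _ _ => Nat.zero_le _)
      (Finset.mem_univ i)
  cases h with
  | star h hn => simp [h, FinTerm.prefixLength, add_assoc]
  | nested h i => simp
  | @var cs i h => have := hs i; simp [h, FinTerm.prefixLength]; omega
  | @arg cs g args vs ds i h hn j hj =>
    have h1 := hs i
    have h2 := Finset.single_le_sum (f := fun j => (args j).prefixLength)
      (fun _ _ => Nat.zero_le _) (Finset.mem_univ j)
    simp only [hj, FinTerm.prefixLength] at h2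
    simp only [h, FinTerm.prefixLength, FinTerm.argsPrefixLength]
    omega

variable (T) in
/-- The equations for `X_{f,⋆}` and `X_{f,i}` as a counter system. -/
def nodeSystem : CounterSystem T.Node where
  edge := NodeEdge
  zero := NodeZero
  finite_edge := by
    have := T.finiteS
    have hB : ∀ f, ∃ B, ∀ ρ ∈ T.rules f,
        ρ.rhs.prefixLength + ∑ i, (ρ.pats i).length + ρ.rhs.argsPrefixLength ≤ B := by
      intro f
      obtain ⟨B, hB⟩ := ((T.finite_rules f).image fun ρ =>
        ρ.rhs.prefixLength + ∑ i, (ρ.pats i).length + ρ.rhs.argsPrefixLength).bddAbove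
      exact ⟨B, fun ρ hρ => hB ⟨ρ, hρ, rfl⟩⟩
    choose B hB using hB
    obtain ⟨K, hK⟩ := (Set.finite_range B).bddAbove
    have hfin : ((Set.univ : Set T.Node) ×ˢ (Set.univ : Set T.Node) ×ˢ Set.Iic (K + 1) ×ˢ
        Set.Iic (K + 1) ×ˢ Set.Iic (K + 1)).Finite :=
      Set.finite_univ.prod (Set.finite_univ.prod ((Set.finite_Iic _).prod
        ((Set.finite_Iic _).prod (Set.finite_Iic _))))
    refine hfin.subset ?_
    rintro ⟨v, w, m, a, d⟩ (⟨-, -, rfl, rfl, rfl⟩ | ⟨f, -, ρ, hρ, he⟩)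
    · simp
    · have h1 := he.le_size
      have h2 := hB f ρ hρ
      have h3 : B f ≤ K := hK ⟨f, rfl⟩
      simp only at h1
      simp only [Set.mem_prod, Set.mem_univ, Set.mem_Iic, true_and]
      omega
  wf := by
    have hnone : Acc (fun w v : T.Node => ∃ a d, NodeEdge v w 0 a d) none := by
      refine ⟨_, fun w ⟨a, d, h⟩ => ?_⟩
      obtain ⟨-, -, h, -⟩ | ⟨f, -, ρ, -, h⟩ := h
      · omega
      · cases h
    -- An edge without output comes from a rule without prefix, so it follows `UnguardedDep`, and
    -- the accessibility of weakly guarded symbols carries over.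
    have hstar : ∀ f, Acc (fun w v : T.Node => ∃ a d, NodeEdge v w 0 a d) (some (.inl f)) := by
      intro f
      by_cases hf : T.WeaklyGuarded f
      · induction hf with
        | intro f hf ih =>
          refine ⟨_, fun w ⟨a, d, h⟩ => ?_⟩
          obtain ⟨h, -⟩ | ⟨f', -, ρ, hρ, h⟩ := h
          · cases h
          -- The output 0 is generalised so that case analysis can unify it with a list length.
          · obtain ⟨m, hm, h⟩ : ∃ m, m = 0 ∧ RuleEdge ρ _ w m a d := ⟨0, rfl, h⟩
            cases h with
            | @star cs g args vs h hn =>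
              obtain rfl := List.length_eq_zero_iff.1 hm
              exact ih g ⟨ρ, hρ, _, _, h⟩
      · refine ⟨_, fun w ⟨a, d, h⟩ => ?_⟩
        obtain ⟨h, -⟩ | ⟨f', hf', ρ, hρ, h⟩ := h
        · cases h
        · obtain ⟨m, hm, h⟩ : ∃ m, m = 0 ∧ RuleEdge ρ _ w m a d := ⟨0, rfl, h⟩
          cases h; exact absurd hf' hf
    have harg : ∀ f i, Acc (fun w v : T.Node => ∃ a d, NodeEdge v w 0 a d)
        (some (.inr ⟨f, i⟩)) := by
      intro f i
      by_cases hf : T.WeaklyGuarded f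
      · induction hf with
        | intro f hf ih =>
          refine ⟨_, fun w ⟨a, d, h⟩ => ?_⟩
          obtain ⟨h, -⟩ | ⟨f', -, ρ, hρ, h⟩ := h
          · cases h
          · obtain ⟨m, hm, h⟩ : ∃ m, m = 0 ∧ RuleEdge ρ _ w m a d := ⟨0, rfl, h⟩
            cases h with
            | nested h i => exact hnone
            | var h => exact hnone
            | @arg cs g args vs ds i h hn j hj =>
              obtain rfl := List.length_eq_zero_iff.1 hm
              exact ih g ⟨ρ, hρ, _, _, h⟩ j
      · refine ⟨_, fun w ⟨a, d, h⟩ => ?_⟩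
        obtain ⟨h, -⟩ | ⟨f', hf', ρ, hρ, h⟩ := h
        · cases h
        · obtain ⟨m, hm, h⟩ : ∃ m, m = 0 ∧ RuleEdge ρ _ w m a d := ⟨0, rfl, h⟩
          cases h <;> exact absurd hf' hf
    exact ⟨fun v => match v with
      | none => hnone
      | some (.inl f) => hstar f
      | some (.inr ⟨f, i⟩) => harg f i⟩
  zero_of_lt := by
    rintro v w m a d n (⟨rfl, rfl, rfl, rfl, rfl⟩ | ⟨f, hf, ρ, hρ, he⟩) hn
    · exact hn
    · cases he with
      | star => simp at hn
      | nested => simp at hn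
      | var h => exact .inr ⟨ρ, hρ, by simp [h, FinTerm.Nested], hn⟩
      | arg h hnn j hj => exact .inr ⟨ρ, hρ, hnn, hn⟩
  zero_anti := by
    rintro (_ | f | ⟨f, i⟩) n n' hn h
    · exact lt_of_le_of_lt hn h
    · exact h
    · obtain h | ⟨ρ, hρ, hnn, h⟩ := h
      · exact .inl h
      · exact .inr ⟨ρ, hρ, hnn, hn.trans_lt h⟩
  zero_top := by
    rintro (_ | f | ⟨f, i⟩) h
    · exact absurd (h 1) (lt_irrefl _)
    · exact h 0
    -- At a counter value `B` no pattern lacks input, so blocking can only come from unguardedness.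
    · obtain ⟨B, hB⟩ := ((T.finite_rules f).image fun ρ => (ρ.pats i).length).bddAbove
      obtain h | ⟨ρ, hρ, hnn, h⟩ := h B
      · exact .inl h
      · have h1 : (ρ.pats i).length ≤ B := hB ⟨ρ, hρ, rfl⟩
        have h2 : B < (ρ.pats i).length := by exact_mod_cast h
        omega

namespace Valuation

/-- The function on nodes that belongs to a valuation. -/
def nodeVal (X : T.Valuation) : T.Node → ℕ∞ → ℕ∞
  | none, n => n
  | some (.inl f), _ => X.star f
  | some (.inr ⟨f, i⟩), n => X.arg f i n

variable {X : T.Valuation}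

theorem isSolutionAt_none : T.nodeSystem.IsSolutionAt X.nodeVal none where
  eq_zero n hn := Order.lt_one_iff.1 hn
  le := by
    rintro w m a d n (⟨-, rfl, rfl, rfl, rfl⟩ | ⟨f, hf, ρ, hρ, he⟩) hn
    · change n ≤ 1 + (n - 1 + 0)
      rw [add_zero]; exact le_add_tsub
    · cases he
  attained n := by
    rcases lt_or_ge n 1 with hn | hn
    · exact .inr (.inl hn)
    · refine .inr (.inr ⟨none, 1, 1, 0, .inl ⟨rfl, rfl, rfl, rfl, rfl⟩, hn, ?_⟩)
      change n = 1 + (n - 1 + 0)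
      rw [add_zero]; exact (add_tsub_cancel_of_le hn).symm

theorem SolvesAt.isSolutionAt_star {f : T.SSym} (h : X.SolvesAt f) :
    T.nodeSystem.IsSolutionAt X.nodeVal (some (.inl f)) where
  eq_zero _ hn := h.star_of_not hn
  le := by
    rintro w m a d n (⟨h, -⟩ | ⟨f', hf, ρ, hρ, he⟩) hn
    · cases h
    · cases he with
      | @star cs g args vs hr hnn =>
        change X.star f ≤ cs.length + X.star g
        rw [h.star_of hf, ← X.starRule_app hr hnn]
        exact iInf₂_le ρ hρ
  attained n := by
    by_cases hf : T.WeaklyGuarded f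
    · obtain ⟨ρ, hρ, heq⟩ := ENat.exists_mem_biInf_eq (rules_nonempty f) X.starRule
      rw [← h.star_of hf] at heq
      by_cases hnn : ρ.rhs.Nested
      · exact .inl (heq.trans (X.starRule_of_nested hnn))
      · cases hr : ρ.rhs with
        | var cs j => exact .inl (heq.trans (X.starRule_var hr))
        | app cs g args vs =>
          exact .inr (.inr ⟨_, _, 0, 0, .inr ⟨f, hf, ρ, hρ, .star hr hnn⟩, by simp,
            heq.trans (X.starRule_app hr hnn)⟩)
    · exact .inr (.inl hf)

theorem SolvesAt.isSolutionAt_arg {f : T.SSym} (h : X.SolvesAt f) (i : Fin (T.sAr f)) :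
    T.nodeSystem.IsSolutionAt X.nodeVal (some (.inr ⟨f, i⟩)) where
  eq_zero n hn := by
    change X.arg f i n = 0
    by_cases hf : T.WeaklyGuarded f
    · obtain hn | ⟨ρ, hρ, hnn, hlt⟩ := hn
      · exact absurd hf hn
      · rw [h.arg_of hf]
        exact le_antisymm ((iInf₂_le ρ hρ).trans (X.argRule_of_lt hnn hlt).le) zero_le
    · exact h.arg_of_not hf i n
  le := by
    classical
    rintro w m a d n (⟨h, -⟩ | ⟨f', hf, ρ, hρ, he⟩) hn
    · cases h
    · cases he with
      | nested hr i =>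
        change X.arg f i n ≤ (0 : ℕ) + (n - (0 : ℕ) + (0 : ℕ))
        rw [h.arg_of hf]
        exact (iInf₂_le ρ hρ).trans (by simp [X.argRule_of_nested hr])
      | @var cs i hr =>
        change X.arg f i n ≤ cs.length + (n - (ρ.pats i).length + (0 : ℕ))
        rw [h.arg_of hf]
        exact (iInf₂_le ρ hρ).trans (by rw [X.argRule_var hr hn]; simp)
      | @arg cs g args vs ds i hr hnn j hj =>
        change X.arg f i n ≤ cs.length + X.arg g j (n - (ρ.pats i).length + ds.length)
        rw [h.arg_of hf]
        refine (iInf₂_le ρ hρ).trans ?_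
        rw [X.argRule_app hr hnn hn]
        refine add_le_add_right ((iInf_le _ j).trans ?_) _
        rw [hj]
        simp
  attained n := by
    classical
    by_cases hf : T.WeaklyGuarded f
    · obtain ⟨ρ, hρ, heq⟩ := ENat.exists_mem_biInf_eq (rules_nonempty f) fun ρ => X.argRule ρ i n
      rw [← h.arg_of hf] at heq
      change X.arg f i n = ⊤ ∨ _
      by_cases hnn : ρ.rhs.Nested
      · refine .inr (.inr ⟨_, _, _, _, .inr ⟨f, hf, ρ, hρ, .nested hnn i⟩, by simp, ?_⟩)
        change X.arg f i n = (0 : ℕ) + (n - (0 : ℕ) + (0 : ℕ))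
        rw [heq, X.argRule_of_nested hnn]; simp
      rcases lt_or_ge n ((ρ.pats i).length : ℕ∞) with hlt | hge
      · exact .inr (.inl (.inr ⟨ρ, hρ, hnn, hlt⟩))
      cases hr : ρ.rhs with
      | var cs j =>
        rw [X.argRule_var hr hge] at heq
        by_cases hij : i = j
        · subst hij
          refine .inr (.inr ⟨_, _, _, _, .inr ⟨f, hf, ρ, hρ, .var hr⟩, hge, ?_⟩)
          change X.arg f i n = cs.length + (n - (ρ.pats i).length + (0 : ℕ))
          rw [heq]; simp
        · left; rw [heq, if_neg hij]; simp
      | app cs g args vs =>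
        rw [X.argRule_app hr hnn hge] at heq
        rcases isEmpty_or_nonempty (Fin (T.sAr g)) with he | hne
        · left; rw [heq]; simp
        obtain ⟨j, hj⟩ := ENat.exists_iInf_eq (fun j => match args j with
          | .var ds p => if p = i then X.arg g j (n - (ρ.pats i).length + ds.length) else ⊤
          | .app _ _ _ _ => ⊤)
        rw [hj] at heq
        cases hargs : args j with
        | app => left; rw [heq, hargs]; simp
        | var ds p =>
          rw [hargs] at heq
          by_cases hp : p = i
          · subst hp
            refine .inr (.inr ⟨_, _, _, _, .inr ⟨f, hf, ρ, hρ, .arg hr hnn j hargs⟩, hge, ?_⟩)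
            change X.arg f p n = cs.length + X.arg g j (n - (ρ.pats p).length + ds.length)
            rw [heq]; simp
          · left; rw [heq]; simp [hp]
    · exact .inr (.inl (.inl hf))

theorem isSolutionAt_nodeVal (h : ∀ f, X.SolvesAt f) (v : T.Node) :
    T.nodeSystem.IsSolutionAt X.nodeVal v :=
  match v with
  | none => isSolutionAt_none
  | some (.inl f) => (h f).isSolutionAt_star
  | some (.inr ⟨f, i⟩) => (h f).isSolutionAt_arg i

theorem periodicallyIncreasing_fn (h : ∀ f, X.SolvesAt f) (f : T.SSym) :
    PeriodicallyIncreasing (X.fn f) := by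
  have := T.finiteS
  exact ⟨X.star f, X.arg f, fun i => CounterSystem.periodicallyIncreasing₁
    (isSolutionAt_nodeVal h) (some (.inr ⟨f, i⟩)), (h f).fn⟩

/-- The symbol of the node, if any, is friendly nesting. -/
def _root_.StreamSpec.FriendlyNestingNode : T.Node → Prop
  | none => True
  | some (.inl f) => T.FriendlyNesting f
  | some (.inr ⟨f, _⟩) => T.FriendlyNesting f

theorem _root_.StreamSpec.FriendlyNestingNode.of_edge {v w : T.Node} {m a d : ℕ}
    (he : T.nodeSystem.edge v w m a d) (hv : FriendlyNestingNode v) : FriendlyNestingNode w := by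
  obtain ⟨-, rfl, -⟩ | ⟨f, -, ρ, hρ, he⟩ := he
  · trivial
  · cases he with
    | star h => exact FriendlyNesting.of_occurs hv hρ (by rw [h]; exact .inl rfl)
    | nested => trivial
    | var => trivial
    | arg h => exact FriendlyNesting.of_occurs hv hρ (by rw [h]; exact .inl rfl)

theorem IsSolution.isSolutionAt (h : X.IsSolution) (v : T.Node) (hv : FriendlyNestingNode v) :
    T.nodeSystem.IsSolutionAt X.nodeVal v :=
  match v, hv with
  | none, _ => isSolutionAt_none
  | some (.inl _), hv => (h.solvesAt hv).isSolutionAt_star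
  | some (.inr ⟨_, i⟩), hv => (h.solvesAt hv).isSolutionAt_arg i

/-- Friendly nesting symbols are closed under dependency, so the comparison of solutions never
leaves the nodes whose equations are known. -/
theorem IsSolution.fn_eq {X' : T.Valuation} (h : X.IsSolution) (h' : X'.IsSolution) {f : T.SSym}
    (hf : T.FriendlyNesting f) : X.fn f = X'.fn f := by
  funext n
  rw [(h.solvesAt hf).fn, (h'.solvesAt hf).fn]
  have key := fun (v : T.Node) (hv : FriendlyNestingNode v) (n : ℕ∞) =>
    CounterSystem.eq_of_isSolutionAt FriendlyNestingNode.of_edge h.isSolutionAt h'.isSolutionAt hv n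
  have h1 : X.star f = X'.star f := key (some (.inl f)) hf 0
  have h2 : ∀ i n, X.arg f i n = X'.arg f i n := fun i n => key (some (.inr ⟨f, i⟩)) hf n
  simp only [h1, h2]

end Valuation

end StreamSpec

/-! ### Data-abstracted terms and rewriting inside contexts -/

namespace AbsTerm

variable {S : StreamSig.{u}} {Y : Type}

/-- The instance of a finite term in which all data terms are replaced by pebbles. -/
def inst (θ : Y → AbsTerm S) : FinTerm S Y → AbsTerm S
  | .var us y => prepend us.length (θ y)
  | .app us g args _ => app us.length g (fun i => inst θ (args i))

/-- The number of pebbles in front. -/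
def front : AbsTerm S → ℕ∞
  | inf => ⊤
  | var n _ => n
  | app n _ _ => n

/-- Removes `k` pebbles in front. -/
def drop (k : ℕ) : AbsTerm S → AbsTerm S
  | inf => inf
  | var n y => var (n - k) y
  | app n g args => app (n - k) g args

@[simp] theorem front_prepend (n : ℕ) (t : AbsTerm S) : (prepend n t).front = n + t.front := by
  cases t <;> simp [prepend, front]

@[simp] theorem drop_prepend (n : ℕ) (t : AbsTerm S) : drop n (prepend n t) = t := by
  cases t <;> simp [prepend, drop]

theorem prepend_drop {n : ℕ} {t : AbsTerm S} (h : n ≤ t.front) : prepend n (drop n t) = t := by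
  cases t with
  | inf => rfl
  | var m y =>
    have : n ≤ m := Nat.cast_le.1 h
    simp [prepend, drop, this]
  | app m g args =>
    have : n ≤ m := Nat.cast_le.1 h
    simp [prepend, drop, this]

@[simp] theorem front_pebbles (n : ℕ∞) (y : ℕ) : (pebbles n y : AbsTerm S).front = n := by
  cases n <;> rfl

@[simp] theorem drop_pebbles (k : ℕ) (n : ℕ∞) (y : ℕ) :
    drop k (pebbles n y : AbsTerm S) = pebbles (n - k) y := by
  cases n <;> rfl

@[simp] theorem prepend_pebbles (k : ℕ) (n : ℕ∞) (y : ℕ) :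
    prepend k (pebbles n y : AbsTerm S) = pebbles (k + n) y := by
  cases n <;> rfl

theorem front_inst (θ : Y → AbsTerm S) (s : FinTerm S Y) : s.prefixLength ≤ (inst θ s).front := by
  cases s with
  | var us y => rw [inst, front_prepend]; exact le_self_add
  | app us g args vs => exact le_rfl

end AbsTerm

namespace StrTerm

variable {S : StreamSig.{u}} {Y : Type}

/-- Removes `k` elements in front. -/
def drop (k : ℕ) : StrTerm S → StrTerm S
  | inf us => inf fun n => us (n + k)
  | var us y => var (us.drop k) y
  | app us g args vs => app (us.drop k) g args vs

/-- The elements in front, continued with `v₀`. -/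
def elems (v₀ : DTerm S) : StrTerm S → ℕ → DTerm S
  | inf us => us
  | var us _ => fun n => us.getD n v₀
  | app us _ _ _ => fun n => us.getD n v₀

theorem abs_prepend (ws : List (DTerm S)) (t : StrTerm S) :
    (prepend ws t).abs = t.abs.prepend ws.length := by
  cases t <;> simp [prepend, abs, AbsTerm.prepend]

theorem abs_inst (τ : ℕ → DTerm S) (θ : Y → StrTerm S) (s : FinTerm S Y) :
    (inst τ θ s).abs = AbsTerm.inst (fun y => (θ y).abs) s := by
  induction s with
  | var us y => simp [inst, AbsTerm.inst, abs_prepend]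
  | app us g args vs ih => simp [inst, AbsTerm.inst, abs, ih]

theorem abs_drop (k : ℕ) (t : StrTerm S) : (drop k t).abs = t.abs.drop k := by
  cases t <;> simp [drop, abs, AbsTerm.drop]

theorem elems_prepend (v₀ : DTerm S) (ws : List (DTerm S)) (t : StrTerm S) {k : ℕ}
    (hk : k < ws.length) : elems v₀ (prepend ws t) k = ws[k] := by
  have : ∀ us : List (DTerm S), (ws ++ us)[k]?.getD v₀ = ws[k] := fun us => by
    rw [List.getElem?_append_left hk]; simp [hk]
  cases t <;> simp [elems, prepend, hk, this]

theorem map_getD_append_drop {α : Type*} (v₀ : α) {us : List α} {k : ℕ} (hk : k ≤ us.length) :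
    (List.range k).map (fun n => us.getD n v₀) ++ us.drop k = us := by
  have : (List.range k).map (fun n => us.getD n v₀) = us.take k := by
    apply List.ext_getElem
    · simp [hk]
    · intro n h1 h2
      simp at h1
      simp [show n < us.length by omega]
  rw [this, List.take_append_drop]

theorem prepend_elems_drop (v₀ : DTerm S) {k : ℕ} {t : StrTerm S} (hk : k ≤ t.abs.front) :
    prepend ((List.range k).map (elems v₀ t)) (drop k t) = t := by
  cases t with
  | inf us =>
    simp only [prepend, drop, elems, List.length_map, List.length_range, inf.injEq]
    funext n
    split_ifs with h
    · simp
    · rw [Nat.sub_add_cancel (by omega)]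
  | var us y =>
    have : k ≤ us.length := Nat.cast_le.1 hk
    simp only [prepend, drop, elems, map_getD_append_drop v₀ this]
  | app us g args vs =>
    have : k ≤ us.length := Nat.cast_le.1 hk
    simp only [prepend, drop, elems, map_getD_append_drop v₀ this]

theorem DataClosed.elems {C : S.DSym → Prop} {v₀ : DTerm S} (hv₀ : v₀.Closed C) {t : StrTerm S}
    (ht : t.DataClosed C) (n : ℕ) : (elems v₀ t n).Closed C := by
  have key : ∀ us : List (DTerm S), (∀ v ∈ us, v.Closed C) → (us.getD n v₀).Closed C := by
    intro us hus
    rcases lt_or_ge n us.length with h | h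
    · simpa [h] using hus _ (List.getElem_mem h)
    · simpa [h] using hv₀
  cases t with
  | inf us => exact ht n
  | var us y => exact key us ht
  | app us g args vs => exact key us ht.1

theorem exists_eq_app_of_abs_eq {t : StrTerm S} {m : ℕ} {f : S.SSym}
    {args : Fin (S.sAr f) → AbsTerm S} (h : t.abs = .app m f args) :
    ∃ us sargs vs, t = app us f sargs vs ∧ us.length = m ∧ (fun i => (sargs i).abs) = args := by
  cases t with
  | inf us => cases h
  | var us y => cases h
  | app us g sargs vs =>
    simp only [abs] at h
    cases h
    exact ⟨us, sargs, vs, rfl, rfl, rfl⟩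

end StrTerm

namespace StreamSpec

variable {T : StreamSpec.{u}}

/-- Exhaustiveness speaks of infinite streams, so the arguments are continued with `v₀`. The rule
found then matches the actual term as soon as the elements it inspects are really present. -/
theorem exists_root_step {f : T.SSym} {us : List (DTerm T.toStreamSig)}
    {args : Fin (T.sAr f) → StrTerm T.toStreamSig} {vs : Fin (T.dAr f) → DTerm T.toStreamSig}
    (h : (StrTerm.app us f args vs).DataClosed (fun c => T.dataRules c = ∅)) :
    ∃ ρ ∈ T.rules f, (∀ i, ((ρ.pats i).length : ℕ∞) ≤ (args i).abs.front) →
      ∃ t, T.Step (.app us f args vs) t ∧ t.abs = AbsTerm.prepend us.length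
        (.inst (fun i => (args i).abs.drop (ρ.pats i).length) ρ.rhs) := by
  obtain ⟨v₀, hv₀⟩ := T.data_nonempty
  obtain ⟨-, hargs, hvs⟩ := h
  obtain ⟨ρ, hρ, τ, θ, hθ, hτ⟩ := T.exhaustive_stream f (fun i => (args i).elems v₀) vs
    (fun i n => (hargs i).elems hv₀ n) hvs
  refine ⟨ρ, hρ, fun hle => ?_⟩
  have hpat : ∀ i, args i =
      ρ.instPat τ (fun i => (args i).drop (ρ.pats i).length) i := by
    intro i
    rw [StreamRule.instPat]
    refine (StrTerm.prepend_elems_drop v₀ (hle i)).symm.trans ?_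
    congr 1
    apply List.ext_getElem
    · simp
    · intro k h1 h2
      have := congr_arg (fun t => t.elems v₀ k) (hθ i)
      simp only [StreamRule.instPat, StrTerm.elems_prepend v₀ _ _ h2] at this
      simpa [StrTerm.elems] using this
  have hstep := Step.root ρ hρ τ (fun i => (args i).drop (ρ.pats i).length) us
  rw [← funext hpat, ← funext hτ] at hstep
  refine ⟨_, hstep, ?_⟩
  rw [StrTerm.abs_prepend, StrTerm.abs_inst]
  simp only [StrTerm.abs_drop]

variable (T) in
/-- The function `C` replaces a hole in a context by its argument: rewrite steps can be lifted from
the hole to the whole term, whatever the data is. -/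
def IsContext (C : AbsTerm T.toStreamSig → AbsTerm T.toStreamSig) : Prop :=
  ∀ s r, s.abs = C r → s.DataClosed (fun c => T.dataRules c = ∅) →
    ∃ s₀ : StrTerm T.toStreamSig, s₀.abs = r ∧ s₀.DataClosed (fun c => T.dataRules c = ∅) ∧
      ∀ t, T.Step s₀ t → ∃ s', T.Step s s' ∧ s'.abs = C t.abs

theorem isContext_id : T.IsContext fun r => r :=
  fun s _ h hs => ⟨s, h, hs, fun t ht => ⟨t, ht, rfl⟩⟩

theorem IsContext.arg {C : AbsTerm T.toStreamSig → AbsTerm T.toStreamSig} (hC : T.IsContext C)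
    (m : ℕ) (f : T.SSym) (args : Fin (T.sAr f) → AbsTerm T.toStreamSig) (i : Fin (T.sAr f)) :
    T.IsContext fun r => C (.app m f (Function.update args i r)) := by
  intro s r hs hcl
  obtain ⟨s₀, h0, hcl0, hstep⟩ := hC s _ hs hcl
  obtain ⟨us, sargs, vs, rfl, hm, hargs⟩ := StrTerm.exists_eq_app_of_abs_eq h0
  refine ⟨sargs i, by simpa using congr_fun hargs i, hcl0.2.1 i, fun t ht => ?_⟩
  obtain ⟨s', h1, h2⟩ := hstep _ (.arg us sargs vs i t ht)
  refine ⟨s', h1, h2.trans ?_⟩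
  simp only [StrTerm.abs, hm]
  congr 2
  funext j
  by_cases hj : j = i
  · subst hj; simp
  · simpa [hj] using congr_fun hargs j

variable {G : AbsTerm T.toStreamSig → StrTerm T.toStreamSig}
  {C : AbsTerm T.toStreamSig → AbsTerm T.toStreamSig}

/-- The data, and with it the rule, is determined by the whole term including the context; whether
the arguments are long enough is checked afterwards. -/
theorem IsContext.exists_step (hG : T.IsDataExchange G) (hC : T.IsContext C) (m : ℕ) (f : T.SSym)
    (args : Fin (T.sAr f) → AbsTerm T.toStreamSig) :
    ∃ ρ ∈ T.rules f, (∀ i, ((ρ.pats i).length : ℕ∞) ≤ (args i).front) →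
      T.ObliviousStep G (C (.app m f args))
        (C (.prepend m (.inst (fun i => (args i).drop (ρ.pats i).length) ρ.rhs))) := by
  obtain ⟨s₀, h0, hcl0, hstep⟩ := hC _ (.app m f args) (hG _).1 (hG _).2
  obtain ⟨us, sargs, vs, rfl, rfl, rfl⟩ := StrTerm.exists_eq_app_of_abs_eq h0
  obtain ⟨ρ, hρ, h⟩ := exists_root_step hcl0
  refine ⟨ρ, hρ, fun hle => ?_⟩
  obtain ⟨t, ht, habs⟩ := h hle
  obtain ⟨s', h1, h2⟩ := hstep t ht
  exact ⟨s', h1, by rw [h2, habs]⟩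

theorem le_production {s t : AbsTerm T.toStreamSig}
    (h : Relation.ReflTransGen (T.ObliviousStep G) s t) {n : ℕ} (hn : n ≤ t.front) :
    n ≤ T.production G s :=
  le_sSup ⟨n, rfl, t.drop n, by rwa [AbsTerm.prepend_drop hn]⟩

theorem production_le {s : AbsTerm T.toStreamSig} {c : ℕ∞}
    (h : ∀ t, Relation.ReflTransGen (T.ObliviousStep G) s t → t.front ≤ c) :
    T.production G s ≤ c := by
  refine sSup_le ?_
  rintro _ ⟨n, rfl, t, ht⟩
  have := h _ ht
  rw [AbsTerm.front_prepend] at this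
  exact le_self_add.trans this

end StreamSpec

/-! ### Terms over friendly symbols -/

namespace AbsTerm

variable {S : StreamSig.{u}} {Y : Type}

/-- A lower bound for the number of pebbles that can be produced if all symbols are friendly. -/
noncomputable def guaranteed : AbsTerm S → ℕ∞
  | inf => ⊤
  | var n _ => n
  | app n _ args => n + ⨅ i, guaranteed (args i)

/-- All stream symbols except `:` satisfy `P`. -/
def AllSyms (P : S.SSym → Prop) : AbsTerm S → Prop
  | inf => True
  | var _ _ => True
  | app _ g args => P g ∧ ∀ i, AllSyms P (args i)

theorem guaranteed_prepend (n : ℕ) (t : AbsTerm S) :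
    (prepend n t).guaranteed = n + t.guaranteed := by
  cases t <;> simp [prepend, guaranteed, add_assoc]

theorem guaranteed_le_add_drop (k : ℕ) (t : AbsTerm S) :
    t.guaranteed ≤ k + (t.drop k).guaranteed := by
  cases t with
  | inf => simp [drop, guaranteed]
  | var n y => simp only [drop, guaranteed]; norm_cast; omega
  | app n g args =>
    simp only [drop, guaranteed]
    rw [← add_assoc]
    gcongr
    norm_cast; omega

theorem le_guaranteed_inst (θ : Y → AbsTerm S) (s : FinTerm S Y) :
    s.prefixLength + ⨅ y, (θ y).guaranteed ≤ (inst θ s).guaranteed := by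
  induction s with
  | var us y =>
    rw [inst, guaranteed_prepend, FinTerm.prefixLength]
    gcongr
    exact iInf_le _ y
  | app us g args vs ih =>
    rw [inst, guaranteed, FinTerm.prefixLength]
    gcongr
    exact le_iInf fun i => le_add_self.trans (ih i)

theorem AllSyms.prepend {P : S.SSym → Prop} {t : AbsTerm S} (h : t.AllSyms P) (n : ℕ) :
    (t.prepend n).AllSyms P := by
  cases t <;> exact h

theorem AllSyms.drop {P : S.SSym → Prop} {t : AbsTerm S} (h : t.AllSyms P) (n : ℕ) :
    (t.drop n).AllSyms P := by
  cases t <;> exact h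

theorem allSyms_pebbles (P : S.SSym → Prop) (n : ℕ∞) (y : ℕ) :
    (pebbles n y : AbsTerm S).AllSyms P := by
  cases n <;> trivial

@[simp] theorem guaranteed_pebbles (n : ℕ∞) (y : ℕ) :
    (pebbles n y : AbsTerm S).guaranteed = n := by
  cases n <;> rfl

theorem AllSyms.inst {P : S.SSym → Prop} {θ : Y → AbsTerm S} (hθ : ∀ y, (θ y).AllSyms P)
    {s : FinTerm S Y} (hs : ∀ g, s.Occurs g → P g) : (inst θ s).AllSyms P := by
  induction s with
  | var us y => exact (hθ y).prepend _
  | app us g args vs ih =>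
    exact ⟨hs g (.inl rfl), fun i => ih i fun g' hg' => hs g' (.inr ⟨i, hg'⟩)⟩

end AbsTerm

theorem ENat.iInf_le_one_add_iInf {ι : Type*} {a b : ι → ℕ∞} (h : ∀ i, a i ≤ 1 + b i) :
    ⨅ i, a i ≤ 1 + ⨅ i, b i := by
  rcases isEmpty_or_nonempty ι with _ | _
  · rw [iInf_of_empty b, add_top]; exact le_top
  · obtain ⟨i, hi⟩ := ENat.exists_iInf_eq b
    rw [hi]
    exact (iInf_le _ i).trans (h i)

namespace StreamSpec

variable {T : StreamSpec.{u}} {G : AbsTerm T.toStreamSig → StrTerm T.toStreamSig}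
  {C : AbsTerm T.toStreamSig → AbsTerm T.toStreamSig}

variable (T) in
def FriendlySym (f : T.SSym) : Prop := ∀ ρ, T.FriendlyRule ⟨f, ρ⟩

theorem FriendlyRule.friendlySym_of_occurs {ρ : T.Rule} (h : T.FriendlyRule ρ) {g : T.SSym}
    (hg : ρ.2.1.rhs.Occurs g) : T.FriendlySym g :=
  fun ρ' γ hγ => h γ (.head (show T.Depends ρ ⟨g, ρ'⟩ from hg) hγ)

/-- The effect of a step with a friendly rule. -/
theorem FriendlyRule.contractum {f : T.SSym} {ρ : StreamRule T.toStreamSig f}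
    {hρ : ρ ∈ T.rules f} (h : T.FriendlyRule ⟨f, ρ, hρ⟩) (m : ℕ)
    {args : Fin (T.sAr f) → AbsTerm T.toStreamSig} (hargs : ∀ i, (args i).AllSyms T.FriendlySym) :
    (AbsTerm.prepend m (.inst (fun i => (args i).drop (ρ.pats i).length) ρ.rhs)).AllSyms
        T.FriendlySym ∧
      m + ⨅ i, (args i).guaranteed ≤
        (AbsTerm.prepend m (.inst (fun i => (args i).drop (ρ.pats i).length) ρ.rhs)).guaranteed ∧
      (m + 1 : ℕ∞) ≤
        (AbsTerm.prepend m (.inst (fun i => (args i).drop (ρ.pats i).length) ρ.rhs)).front := by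
  obtain ⟨h1, h2⟩ := h _ .refl
  simp only at h1 h2
  have h2' : (1 : ℕ∞) ≤ ρ.rhs.prefixLength := by exact_mod_cast h2
  refine ⟨.prepend (.inst (fun i => (hargs i).drop _) fun g hg => h.friendlySym_of_occurs hg) m,
    ?_, ?_⟩
  · rw [AbsTerm.guaranteed_prepend]
    gcongr
    refine le_trans ?_ (AbsTerm.le_guaranteed_inst _ _)
    -- Consumption lowers the minimum of the guarantees by at most one, which the prefix of the
    -- right-hand side compensates.
    refine le_trans ?_ (add_le_add_left h2' _)
    refine ENat.iInf_le_one_add_iInf fun i =>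
      (AbsTerm.guaranteed_le_add_drop (ρ.pats i).length _).trans ?_
    gcongr
    exact_mod_cast h1 i
  · rw [AbsTerm.front_prepend]
    gcongr
    exact h2'.trans (AbsTerm.front_inst _ _)

/-- Arguments can be rewritten one after the other. -/
theorem exists_reflTransGen_args {m : ℕ} {f : T.SSym}
    {args : Fin (T.sAr f) → AbsTerm T.toStreamSig}
    {P : Fin (T.sAr f) → AbsTerm T.toStreamSig → Prop} (hC : T.IsContext C)
    (h : ∀ i, ∀ C', T.IsContext C' →
      ∃ t, Relation.ReflTransGen (T.ObliviousStep G) (C' (args i)) (C' t) ∧ P i t) :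
    ∃ args', Relation.ReflTransGen (T.ObliviousStep G) (C (.app m f args)) (C (.app m f args')) ∧
      ∀ i, P i (args' i) := by
  -- Positions not yet treated keep their original argument, so the hypothesis still applies to
  -- them.
  have key : ∀ s : Finset (Fin (T.sAr f)), ∃ args', Relation.ReflTransGen (T.ObliviousStep G)
      (C (.app m f args)) (C (.app m f args')) ∧ (∀ i ∈ s, P i (args' i)) ∧
        ∀ i ∉ s, args' i = args i := by
    intro s
    induction s using Finset.induction_on with
    | empty => exact ⟨args, .refl, by simp, by simp⟩
    | insert i s hi ih =>
      obtain ⟨args', hr, h1, h2⟩ := ih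
      obtain ⟨t, ht, hP⟩ := h i _ (hC.arg m f args' i)
      rw [← h2 i hi] at ht
      simp only [Function.update_eq_self] at ht
      refine ⟨Function.update args' i t, hr.trans ht, fun j hj => ?_, fun j hj => ?_⟩
      · by_cases hji : j = i
        · subst hji; simpa using hP
        · simpa [hji] using h1 j (Finset.mem_of_mem_insert_of_ne hj hji)
      · rw [Finset.mem_insert, not_or] at hj
        simpa [hj.1] using h2 j hj.2
  obtain ⟨args', hr, h1, -⟩ := key Finset.univ
  exact ⟨args', hr, fun i => h1 i (Finset.mem_univ i)⟩

/-- A guarantee beyond the front means that all arguments have a positive guarantee. By induction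
each argument without pebbles can be made to produce one; then any friendly rule applies at the root
and adds at least one pebble. -/
theorem exists_reflTransGen_succ_front (hG : T.IsDataExchange G) (t : AbsTerm T.toStreamSig)
    (ht : t.AllSyms T.FriendlySym) (hlt : t.front < t.guaranteed)
    (C : AbsTerm T.toStreamSig → AbsTerm T.toStreamSig) (hC : T.IsContext C) :
    ∃ t', Relation.ReflTransGen (T.ObliviousStep G) (C t) (C t') ∧ t'.AllSyms T.FriendlySym ∧
      t.guaranteed ≤ t'.guaranteed ∧ t.front + 1 ≤ t'.front := by
  induction t generalizing C with
  | inf => exact absurd hlt (lt_irrefl _)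
  | var n y => exact absurd hlt (lt_irrefl _)
  | app m f args ih =>
    obtain ⟨hf, hargs⟩ := ht
    have hpos : ∀ i, 0 < (args i).guaranteed := by
      intro i
      refine lt_of_lt_of_le ?_ (iInf_le (fun i => (args i).guaranteed) i)
      by_contra h0
      rw [not_lt, nonpos_iff_eq_zero] at h0
      simp [AbsTerm.front, AbsTerm.guaranteed, h0] at hlt
    obtain ⟨args', hr, h'⟩ := exists_reflTransGen_args (G := G) (m := m) (args := args)
      (P := fun i t' => t'.AllSyms T.FriendlySym ∧ (args i).guaranteed ≤ t'.guaranteed ∧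
        1 ≤ t'.front) hC (by
      intro i C' hC'
      rcases eq_or_ne (args i).front 0 with h0 | h0
      · obtain ⟨t', h1, h2, h3, h4⟩ := ih i (hargs i) (h0 ▸ hpos i) C' hC'
        exact ⟨t', h1, h2, h3, by simpa [h0] using h4⟩
      · exact ⟨args i, .refl, hargs i, le_rfl, Order.one_le_iff_ne_zero.2 h0⟩)
    obtain ⟨ρ, hρ, hstep⟩ := hC.exists_step hG m f args'
    have hfr := hf ⟨ρ, hρ⟩
    obtain ⟨h1, h2, h3⟩ := hfr.contractum m fun i => (h' i).1
    refine ⟨_, hr.tail (hstep fun i => ?_), h1, le_trans ?_ h2, h3⟩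
    · exact le_trans (by exact_mod_cast (hfr _ .refl).1 i) (h' i).2.2
    · rw [AbsTerm.guaranteed]
      gcongr with i
      exact (h' i).2.1

theorem le_production_of_friendly (hG : T.IsDataExchange G) {s t : AbsTerm T.toStreamSig}
    (hst : Relation.ReflTransGen (T.ObliviousStep G) s t) (ht : t.AllSyms T.FriendlySym) {n : ℕ}
    (hn : n ≤ t.guaranteed) : n ≤ T.production G s := by
  have key : ∀ n : ℕ, n ≤ t.guaranteed → ∃ t', Relation.ReflTransGen (T.ObliviousStep G) s t' ∧
      t'.AllSyms T.FriendlySym ∧ t.guaranteed ≤ t'.guaranteed ∧ n ≤ t'.front := by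
    intro n
    induction n with
    | zero => exact fun _ => ⟨t, hst, ht, le_rfl, by simp⟩
    | succ n ih =>
      intro hn
      obtain ⟨t', h1, h2, h3, h4⟩ := ih (le_trans (by norm_cast; omega) hn)
      by_cases hlt : t'.front < (n + 1 : ℕ)
      · obtain ⟨t'', h5, h6, h7, h8⟩ := exists_reflTransGen_succ_front hG t' h2
          (hlt.trans_le (hn.trans h3)) _ isContext_id
        refine ⟨t'', h1.trans h5, h6, h3.trans h7, le_trans ?_ h8⟩
        push_cast
        gcongr
      · exact ⟨t', h1, h2, h3, not_lt.1 hlt⟩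
  obtain ⟨t', h1, -, -, h4⟩ := key n hn
  exact le_production h1 h4

end StreamSpec

/-! ### The recursive equation for a single rule -/

namespace StreamSpec

variable {T : StreamSpec.{u}}

/-- The arguments of the root of the contractum of a rule with right-hand side
`c₁ : … : cₘ : g(s₁, …, sₖ)`, for a redex with `n i` elements in the `i`-th argument. -/
def nextArgs {f g : T.SSym} (ρ : StreamRule T.toStreamSig f)
    (args : Fin (T.sAr g) → FinTerm T.toStreamSig (Fin (T.sAr f))) (n : Fin (T.sAr f) → ℕ∞)
    (j : Fin (T.sAr g)) : ℕ∞ :=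
  match args j with
  | .var ds p => n p - (ρ.pats p).length + ds.length
  -- A dummy value, irrelevant for rules that are not nesting.
  | .app _ _ _ _ => 0

namespace Valuation

variable (X : T.Valuation)

/-- The part of the right-hand side of the equation for `X_f` that belongs to the rule `ρ`. -/
noncomputable def ruleValue {f : T.SSym} (ρ : StreamRule T.toStreamSig f)
    (n : Fin (T.sAr f) → ℕ∞) : ℕ∞ :=
  min (X.starRule ρ) (⨅ i, X.argRule ρ i (n i))

variable {X} {f : T.SSym} {ρ : StreamRule T.toStreamSig f} {n : Fin (T.sAr f) → ℕ∞}

theorem SolvesAt.fn_of_not (h : X.SolvesAt f) (hf : ¬ T.WeaklyGuarded f) : X.fn f n = 0 := by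
  rw [h.fn, h.star_of_not hf]
  exact min_eq_left zero_le

theorem SolvesAt.fn_le_ruleValue (h : X.SolvesAt f) (hf : T.WeaklyGuarded f)
    (hρ : ρ ∈ T.rules f) : X.fn f n ≤ X.ruleValue ρ n := by
  rw [h.fn, ruleValue, h.star_of hf]
  gcongr with i
  · exact iInf₂_le ρ hρ
  · rw [h.arg_of hf]
    exact iInf₂_le ρ hρ

theorem SolvesAt.exists_fn_eq (h : X.SolvesAt f) :
    X.fn f n = X.star f ∨ ∃ i, X.fn f n = X.arg f i (n i) := by
  rw [h.fn]
  rcases min_choice (X.star f) (⨅ i, X.arg f i (n i)) with hm | hm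
  · exact .inl hm
  · rcases isEmpty_or_nonempty (Fin (T.sAr f)) with _ | _
    · exact .inl (by simp)
    · obtain ⟨i, hi⟩ := ENat.exists_iInf_eq fun i => X.arg f i (n i)
      exact .inr ⟨i, hm.trans hi⟩

/-- The minimum is attained by `X_{f,⋆}` or by one argument, and a rule attaining that component
attains the whole. -/
theorem SolvesAt.exists_ruleValue (h : X.SolvesAt f) (hf : T.WeaklyGuarded f) :
    ∃ ρ ∈ T.rules f, X.fn f n = X.ruleValue ρ n := by
  rcases h.exists_fn_eq (n := n) with heq | ⟨i, heq⟩
  · obtain ⟨ρ, hρ, hmin⟩ := ENat.exists_mem_biInf_eq (rules_nonempty f) X.starRule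
    refine ⟨ρ, hρ, (h.fn_le_ruleValue hf hρ).antisymm ?_⟩
    rw [heq, h.star_of hf, hmin]
    exact min_le_left _ _
  · obtain ⟨ρ, hρ, hmin⟩ := ENat.exists_mem_biInf_eq (rules_nonempty f)
      fun ρ => X.argRule ρ i (n i)
    refine ⟨ρ, hρ, (h.fn_le_ruleValue hf hρ).antisymm ?_⟩
    rw [heq, h.arg_of hf, hmin]
    exact (min_le_right _ _).trans (iInf_le _ i)

theorem ruleValue_of_nested (hn : ρ.rhs.Nested) : X.ruleValue ρ n = ⨅ i, n i := by
  simp [ruleValue, X.starRule_of_nested hn, X.argRule_of_nested hn]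

theorem ruleValue_of_lt (hn : ¬ ρ.rhs.Nested) {i} (hi : n i < (ρ.pats i).length) :
    X.ruleValue ρ n = 0 :=
  le_antisymm ((min_le_right _ _).trans ((iInf_le _ i).trans (X.argRule_of_lt hn hi).le)) zero_le

theorem ruleValue_var {cs j} (h : ρ.rhs = .var cs j)
    (hn : ∀ i, ((ρ.pats i).length : ℕ∞) ≤ n i) :
    X.ruleValue ρ n = cs.length + (n j - (ρ.pats j).length) := by
  classical
  rw [ruleValue, X.starRule_var h, top_inf_eq]
  refine le_antisymm ((iInf_le _ j).trans (by rw [X.argRule_var h (hn j)]; simp))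
    (le_iInf fun i => ?_)
  rw [X.argRule_var h (hn i)]
  by_cases hij : i = j
  · subst hij; simp
  · simp [hij]

/-- Every argument of `g` has exactly one source variable, so the infima over the `j` with `π(j) =
i`, taken over all `i`, combine to the infimum over all `j`. -/
theorem ruleValue_app {cs g args vs} (hg : X.SolvesAt g) (h : ρ.rhs = .app cs g args vs)
    (hnn : ¬ ρ.rhs.Nested) (hn : ∀ i, ((ρ.pats i).length : ℕ∞) ≤ n i) :
    X.ruleValue ρ n = cs.length + X.fn g (nextArgs ρ args n) := by
  classical
  rw [ruleValue, X.starRule_app h hnn]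
  apply le_antisymm
  · rcases hg.exists_fn_eq (n := nextArgs ρ args n) with heq | ⟨j, heq⟩
    · rw [heq]; exact min_le_left _ _
    · obtain ⟨ds, p, hj⟩ := FinTerm.exists_eq_var_of_not_isApp
        (fun hj => hnn (by rw [h]; exact ⟨j, hj⟩) : ¬ (args j).IsApp)
      refine (min_le_right _ _).trans ((iInf_le _ p).trans ?_)
      rw [X.argRule_app h hnn (hn p), heq]
      gcongr
      refine (iInf_le _ j).trans ?_
      simp [hj, nextArgs]
  · rw [hg.fn]
    refine le_min (by gcongr; exact min_le_left _ _) (le_iInf fun i => ?_)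
    rw [X.argRule_app h hnn (hn i)]
    gcongr
    refine le_iInf fun j => (min_le_right _ _).trans ((iInf_le _ j).trans ?_)
    cases hj : args j with
    | app => exact le_top
    | var ds p =>
      simp only
      split_ifs with hp
      · subst hp; simp [nextArgs, hj]
      · exact le_top

end Valuation

/-- The data-abstracted contractum for a rule that is not nesting. -/
theorem inst_pebbles_of_not_nested {f g : T.SSym} {ρ : StreamRule T.toStreamSig f} {cs args vs}
    (h : ρ.rhs = .app cs g args vs) (hnn : ¬ ρ.rhs.Nested) (n : Fin (T.sAr f) → ℕ∞)
    (y : Fin (T.sAr f) → ℕ) :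
    ∃ y' : Fin (T.sAr g) → ℕ,
      AbsTerm.inst (fun i => .pebbles (n i - (ρ.pats i).length) (y i)) ρ.rhs =
        .app cs.length g fun j => .pebbles (nextArgs ρ args n j) (y' j) := by
  have key : ∀ j, ∃ y', AbsTerm.inst (fun i => .pebbles (n i - (ρ.pats i).length) (y i)) (args j) =
      (.pebbles (nextArgs ρ args n j) y' : AbsTerm T.toStreamSig) := by
    intro j
    obtain ⟨ds, p, hj⟩ := FinTerm.exists_eq_var_of_not_isApp
      (fun hj => hnn (by rw [h]; exact ⟨j, hj⟩) : ¬ (args j).IsApp)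
    exact ⟨y p, by simp [hj, AbsTerm.inst, nextArgs, add_comm]⟩
  choose y' hy' using key
  exact ⟨y', by rw [h, AbsTerm.inst, funext hy']⟩

/-! ### The lower estimate -/

/-- Here `m` counts the pebbles already produced and `K` those still claimed. The induction is on
`K` and, for fixed `K`, on the accessibility given by weak guardedness. -/
theorem le_production_of_le_fn {X : T.Valuation} (hX : ∀ f, X.SolvesAt f)
    {G : AbsTerm T.toStreamSig → StrTerm T.toStreamSig} (hG : T.IsDataExchange G) (K : ℕ)
    {f : T.SSym} (hf : T.FriendlyNesting f) {n : Fin (T.sAr f) → ℕ∞} {m : ℕ}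
    {y : Fin (T.sAr f) → ℕ} {s : AbsTerm T.toStreamSig} (hK : K ≤ X.fn f n)
    (hs : Relation.ReflTransGen (T.ObliviousStep G) s (.app m f fun i => .pebbles (n i) (y i))) :
    (m + K : ℕ) ≤ T.production G s := by
  induction K using Nat.strong_induction_on generalizing f m with
  | _ K ihK =>
  rcases Nat.eq_zero_or_pos K with rfl | hpos
  · exact le_production hs (by simp [AbsTerm.front])
  have hpos' : (1 : ℕ∞) ≤ K := by exact_mod_cast hpos
  have hwg : T.WeaklyGuarded f := by
    by_contra hwg
    rw [(hX f).fn_of_not hwg] at hK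
    exact absurd (hpos'.trans hK) (by simp)
  induction hwg generalizing m with
  | intro f hacc ih =>
  have hwg : T.WeaklyGuarded f := ⟨f, hacc⟩
  obtain ⟨ρ, hρ, hstep⟩ := isContext_id.exists_step hG m f fun i => .pebbles (n i) (y i)
  have hK' := hK.trans ((hX f).fn_le_ruleValue hwg hρ)
  by_cases hnn : ρ.rhs.Nested
  · rw [Valuation.ruleValue_of_nested hnn] at hK'
    -- From here on, all symbols in the term are friendly, and the minimum of the inputs is
    -- guaranteed.
    have hfr : T.FriendlyRule ⟨f, ρ, hρ⟩ :=
      (hf ⟨ρ, hρ⟩ _ .refl).resolve_right (not_not_intro hnn)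
    obtain ⟨h1, h2, -⟩ := hfr.contractum m
      fun i => AbsTerm.allSyms_pebbles T.FriendlySym (n i) (y i)
    refine le_production_of_friendly hG (hs.tail (hstep fun i => ?_)) h1 (le_trans ?_ h2)
    · rw [AbsTerm.front_pebbles]
      refine le_trans ?_ ((hpos'.trans hK').trans (iInf_le _ i))
      exact_mod_cast (hfr _ .refl).1 i
    · simp only [AbsTerm.guaranteed_pebbles]
      push_cast
      gcongr
  have hlen : ∀ i, ((ρ.pats i).length : ℕ∞) ≤ n i := by
    intro i
    by_contra hlt
    rw [Valuation.ruleValue_of_lt hnn (not_le.1 hlt)] at hK'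
    exact absurd (hpos'.trans hK') (by simp)
  have hr := hs.tail (hstep fun i => by simpa using hlen i)
  simp only [AbsTerm.drop_pebbles] at hr
  cases hrhs : ρ.rhs with
  | var cs j =>
    rw [Valuation.ruleValue_var hrhs hlen] at hK'
    refine le_production hr ?_
    rw [hrhs, AbsTerm.inst, AbsTerm.prepend_pebbles, AbsTerm.prepend_pebbles,
      AbsTerm.front_pebbles]
    push_cast
    gcongr
  | app cs g args vs =>
    rw [Valuation.ruleValue_app (hX g) hrhs hnn hlen] at hK'
    obtain ⟨y', hy'⟩ := inst_pebbles_of_not_nested hrhs hnn n y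
    rw [hy', AbsTerm.prepend] at hr
    have hg : T.FriendlyNesting g := hf.of_occurs hρ (by rw [hrhs]; exact .inl rfl)
    -- An empty prefix leaves `K` unchanged but is an unguarded step; a nonempty one lowers `K`.
    rcases List.eq_nil_or_concat cs with rfl | ⟨l, c, rfl⟩
    · simp only [List.length_nil, Nat.cast_zero, zero_add, add_zero] at hK' hr
      exact ih g ⟨ρ, hρ, args, vs, hrhs⟩ hg hK' hr
    · have := ihK (K - (l.concat c).length) (by simp; omega) hg
        (by rw [ENat.natCast_sub]; exact tsub_le_iff_left.2 hK') hr
      exact le_trans (by norm_cast; omega) this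

theorem fn_le_doLow {X : T.Valuation} (hX : ∀ f, X.SolvesAt f) {f : T.SSym}
    (hf : T.FriendlyNesting f) (n : Fin (T.sAr f) → ℕ∞) : X.fn f n ≤ T.doLow f n := by
  refine le_sInf ?_
  rintro _ ⟨G, hG, rfl⟩
  refine ENat.forall_natCast_le_iff_le.1 fun K hK => ?_
  simpa using le_production_of_le_fn hX hG K hf (m := 0) hK .refl

/-! ### The upper estimate -/

theorem _root_.DTerm.SymsIn.closed_subst {S : StreamSig.{u}} {P : S.DSym → Prop} {t : DTerm S}
    (ht : t.SymsIn P) {τ : ℕ → DTerm S} (hτ : ∀ x, (τ x).Closed P) : (t.subst τ).Closed P := by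
  induction t with
  | var x => exact hτ x
  | app d args ih => exact ⟨ht.1, fun i => ih i (ht.2 i)⟩

/-- The term with data abstraction `t` whose elements in front are those of `ws`, and whose
remaining data is `v₀`. -/
def fill (v₀ : DTerm T.toStreamSig) :
    AbsTerm T.toStreamSig → List (DTerm T.toStreamSig) → StrTerm T.toStreamSig
  | .inf, ws => .inf fun n => ws.getD n v₀
  | .var m y, ws => .var ((List.range m).map fun n => ws.getD n v₀) y
  | .app m g args, ws =>
      .app ((List.range m).map fun n => ws.getD n v₀) g (fun i => fill v₀ (args i) []) fun _ => v₀

theorem abs_fill (v₀ : DTerm T.toStreamSig) (t : AbsTerm T.toStreamSig)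
    (ws : List (DTerm T.toStreamSig)) : (fill v₀ t ws).abs = t := by
  induction t generalizing ws with
  | inf => rfl
  | var m y => simp [fill, StrTerm.abs]
  | app m g args ih => simp [fill, StrTerm.abs, ih]

theorem dataClosed_fill {P : T.DSym → Prop} {v₀ : DTerm T.toStreamSig} (hv₀ : v₀.Closed P)
    (t : AbsTerm T.toStreamSig) {ws : List (DTerm T.toStreamSig)} (hws : ∀ v ∈ ws, v.Closed P) :
    (fill v₀ t ws).DataClosed P := by
  have key : ∀ {ws : List (DTerm T.toStreamSig)}, (∀ v ∈ ws, v.Closed P) →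
      ∀ n, (ws.getD n v₀).Closed P := by
    intro us hus n
    rcases lt_or_ge n us.length with h | h
    · simpa [h] using hus _ (List.getElem_mem h)
    · simpa [h] using hv₀
  have key' : ∀ {ws : List (DTerm T.toStreamSig)}, (∀ v ∈ ws, v.Closed P) →
      ∀ m, ∀ v ∈ (List.range m).map (fun n => ws.getD n v₀), v.Closed P := by
    intro us hus m v hv
    obtain ⟨n, -, rfl⟩ := List.mem_map.1 hv
    exact key hus n
  induction t generalizing ws with
  | inf => exact key hws
  | var m y => exact key' hws m
  | app m g args ih => exact ⟨key' hws m, fun i => ih i (by simp), fun _ => hv₀⟩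

theorem elems_fill (v₀ : DTerm T.toStreamSig) (t : AbsTerm T.toStreamSig)
    (ws : List (DTerm T.toStreamSig)) {k : ℕ} (hk : k < t.front) :
    (fill v₀ t ws).elems v₀ k = ws.getD k v₀ := by
  cases t with
  | inf => rfl
  | var m y =>
    have : k < m := Nat.cast_lt.1 hk
    simp [fill, StrTerm.elems, this]
  | app m g args =>
    have : k < m := Nat.cast_lt.1 hk
    simp [fill, StrTerm.elems, this]

/-- If the data is chosen to fit the rule `ρ`, then no other rule is applicable. -/
theorem eq_of_instPat_eq_fill {f : T.SSym} {ρ γ : StreamRule T.toStreamSig f}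
    (hρ : ρ ∈ T.rules f) (hγ : γ ∈ T.rules f) {v₀ : DTerm T.toStreamSig}
    {args : Fin (T.sAr f) → AbsTerm T.toStreamSig} {τ : ℕ → DTerm T.toStreamSig}
    {θ : Fin (T.sAr f) → StrTerm T.toStreamSig}
    (h : ∀ i, fill v₀ (args i) ((ρ.pats i).map (DTerm.subst fun _ => v₀)) = γ.instPat τ θ i)
    (h' : ∀ i, (ρ.dpats i).subst (fun _ => v₀) = (γ.dpats i).subst τ) : ρ = γ := by
  by_contra hne
  -- Continued with `v₀` to infinite streams, the arguments become a common instance of both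
  -- left-hand sides, contrary to orthogonality.
  let σ : Fin (T.sAr f) → ℕ → DTerm T.toStreamSig := fun i k =>
    ((ρ.pats i).map (DTerm.subst fun _ => v₀)).getD k v₀
  refine T.nonoverlap_stream f ρ hρ γ hγ hne ⟨fun _ => v₀, τ, fun _ => .inf fun _ => v₀,
    fun i => .inf fun k => σ i (k + (γ.pats i).length), fun i => ?_, h'⟩
  simp only [StreamRule.instPat, StrTerm.prepend, StrTerm.inf.injEq]
  funext k
  have hl : (if h : k < ((ρ.pats i).map (DTerm.subst fun _ => v₀)).length
      then ((ρ.pats i).map (DTerm.subst fun _ => v₀))[k] else v₀) = σ i k := by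
    simp only [σ]
    split_ifs with hk
    · rw [List.getD_eq_getElem _ _ hk]
    · rw [List.getD_eq_default _ _ (not_lt.1 hk)]
  rw [hl]
  split_ifs with hk
  -- As `γ` matches, the positions it inspects lie in front of the argument, where `fill` agrees
  -- with `σ i`.
  · have hfront : (k : ℕ∞) < (args i).front := by
      have := congr_arg (fun t => t.abs.front) (h i)
      simp only [abs_fill, StreamRule.instPat, StrTerm.abs_prepend, AbsTerm.front_prepend] at this
      rw [this]
      exact lt_of_lt_of_le (by exact_mod_cast hk) le_self_add
    have := congr_arg (fun t => t.elems v₀ k) (h i)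
    simp only [elems_fill v₀ _ _ hfront, StreamRule.instPat, StrTerm.elems_prepend v₀ _ _ hk] at this
    exact this
  · simp only [List.length_map] at hk ⊢
    rw [Nat.sub_add_cancel (not_lt.1 hk)]

theorem Step.abs_eq_of_pebbles {s t : StrTerm T.toStreamSig} (h : T.Step s t) {n : ℕ∞} {y : ℕ}
    (hs : s.abs = .pebbles n y) : t.abs = s.abs := by
  cases h with
  | root => cases n <;> cases hs
  | arg => cases n <;> cases hs
  | dataArg => cases n <;> cases hs
  | elem => simp [StrTerm.abs_prepend]

/-- With arguments free of stream symbols, only a step at the root can change the data abstraction.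
-/
theorem Step.cases_of_pebbles {f : T.SSym} {us : List (DTerm T.toStreamSig)}
    {args : Fin (T.sAr f) → StrTerm T.toStreamSig} {vs : Fin (T.dAr f) → DTerm T.toStreamSig}
    {s t : StrTerm T.toStreamSig} (h : T.Step s t) (hs : s = .app us f args vs)
    {n : Fin (T.sAr f) → ℕ∞} {y : Fin (T.sAr f) → ℕ}
    (hargs : ∀ i, (args i).abs = .pebbles (n i) (y i)) :
    t.abs = s.abs ∨ ∃ ρ ∈ T.rules f, ∃ τ θ, args = ρ.instPat τ θ ∧
      (vs = fun i => (ρ.dpats i).subst τ) ∧ t = .prepend us (.inst τ θ ρ.rhs) := by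
  cases h with
  | root ρ hρ τ θ us => cases hs; exact .inr ⟨ρ, hρ, τ, θ, rfl, rfl, rfl⟩
  | arg us args vs i t h =>
    cases hs
    left
    simp only [StrTerm.abs]
    congr 1
    funext j
    by_cases hj : j = i
    · subst hj; simpa using h.abs_eq_of_pebbles (hargs j)
    · simp [hj]
  | dataArg => cases hs; exact .inl rfl
  | elem => left; simp [StrTerm.abs_prepend]

/-- For unguarded symbols, an optimal rule has an unguarded root on the right-hand side. -/
theorem exists_optimal_rule {X : T.Valuation} (hX : ∀ f, X.SolvesAt f) (f : T.SSym)
    (n : Fin (T.sAr f) → ℕ∞) : ∃ ρ ∈ T.rules f,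
      (T.WeaklyGuarded f → X.fn f n = X.ruleValue ρ n) ∧
      (¬ T.WeaklyGuarded f → ∃ g args vs, ρ.rhs = .app [] g args vs ∧ ¬ T.WeaklyGuarded g) := by
  by_cases hf : T.WeaklyGuarded f
  · obtain ⟨ρ, hρ, h⟩ := (hX f).exists_ruleValue hf (n := n)
    exact ⟨ρ, hρ, fun _ => h, fun h => absurd hf h⟩
  · obtain ⟨g, ⟨ρ, hρ, args, vs, h⟩, hg⟩ : ∃ g, T.UnguardedDep f g ∧ ¬ T.WeaklyGuarded g := by
      by_contra hcon
      push Not at hcon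
      exact hf ⟨f, hcon⟩
    exact ⟨ρ, hρ, fun h => absurd h hf, fun _ => ⟨g, args, vs, h, hg⟩⟩

/-- The data-exchange function that enforces the rule `sel f n` for terms with root `f` and with
`n i` elements in front of the `i`-th argument. -/
noncomputable def adversary (v₀ : DTerm T.toStreamSig)
    (sel : ∀ f : T.SSym, (Fin (T.sAr f) → ℕ∞) → StreamRule T.toStreamSig f) :
    AbsTerm T.toStreamSig → StrTerm T.toStreamSig
  | .app m f args => .app (List.replicate m v₀) f
      (fun i => fill v₀ (args i)
        (((sel f fun i => (args i).front).pats i).map (DTerm.subst fun _ => v₀)))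
      fun i => ((sel f fun i => (args i).front).dpats i).subst fun _ => v₀
  | t => fill v₀ t []

theorem isDataExchange_adversary {v₀ : DTerm T.toStreamSig}
    (hv₀ : v₀.Closed (fun c => T.dataRules c = ∅))
    {sel : ∀ f : T.SSym, (Fin (T.sAr f) → ℕ∞) → StreamRule T.toStreamSig f}
    (hsel : ∀ f n, sel f n ∈ T.rules f) : T.IsDataExchange (adversary v₀ sel) := by
  intro t
  cases t with
  | inf => exact ⟨abs_fill _ _ _, dataClosed_fill hv₀ _ (by simp)⟩
  | var m y => exact ⟨abs_fill _ _ _, dataClosed_fill hv₀ _ (by simp)⟩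
  | app m f args =>
    obtain ⟨h1, h2⟩ := T.ctor_stream f _ (hsel f fun i => (args i).front)
    refine ⟨by simp [adversary, StrTerm.abs, abs_fill], fun v hv => ?_, fun i => ?_, fun i => ?_⟩
    · rw [List.eq_of_mem_replicate hv]; exact hv₀
    · refine dataClosed_fill hv₀ _ fun v hv => ?_
      obtain ⟨p, hp, rfl⟩ := List.mem_map.1 hv
      exact (h1 i p hp).closed_subst fun _ => hv₀
    · exact (h2 i).closed_subst fun _ => hv₀

/-- The adversary always enforces an optimal rule, so the recursive equation holds with equality
along its rewrite sequences, except at unguarded symbols, from which nothing is ever produced. -/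
theorem doLow_le_fn {X : T.Valuation} (hX : ∀ f, X.SolvesAt f) {f : T.SSym} (hf : T.Flat f)
    (n : Fin (T.sAr f) → ℕ∞) : T.doLow f n ≤ X.fn f n := by
  obtain ⟨v₀, hv₀⟩ := T.data_nonempty
  choose sel hsel hsel₁ hsel₂ using exists_optimal_rule hX
  have hG := isDataExchange_adversary hv₀ hsel
  have hle : T.doLow f n ≤
      T.production (adversary v₀ sel) (.app 0 f fun i => .pebbles (n i) i) :=
    sInf_le ⟨_, hG, rfl⟩
  refine hle.trans (production_le fun r hr => ?_)
  -- Flatness keeps every reachable term in one of two shapes: pebbles only, or one stream symbol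
  -- applied to pebbles. The production so far plus the value of the rest is bounded by the initial
  -- value.
  have inv : (∃ n' y, r = .pebbles n' y ∧ n' ≤ X.fn f n) ∨
      ∃ m g, ∃ (n' : Fin (T.sAr g) → ℕ∞) (y : Fin (T.sAr g) → ℕ), T.Flat g ∧ r = .app m g (fun i => .pebbles (n' i) (y i)) ∧
        m + X.fn g n' ≤ X.fn f n := by
    induction hr with
    | refl => exact .inr ⟨0, f, n, _, hf, rfl, by simp⟩
    | @tail b c hr hstep ih =>
      obtain ⟨t, hstep, rfl⟩ := hstep
      obtain ⟨n', y, rfl, hle⟩ | ⟨m, g, n', y, hg, rfl, hle⟩ := ih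
      · have := hstep.abs_eq_of_pebbles (hG _).1
        rw [(hG _).1] at this
        exact .inl ⟨n', y, this, hle⟩
      · have hs := hstep.cases_of_pebbles rfl (n := n') (y := y) fun i => abs_fill _ _ _
        simp only [AbsTerm.front_pebbles] at hs
        obtain hs | ⟨γ, hγ, τ, θ, hargs, hvs, rfl⟩ := hs
        · rw [(hG _).1] at hs
          exact .inr ⟨m, g, n', y, hg, hs, hle⟩
        obtain rfl := eq_of_instPat_eq_fill (hsel g n') hγ (congr_fun hargs) (congr_fun hvs)
        have hflat : ¬ (sel g n').rhs.Nested := hg ⟨_, hγ⟩ _ .refl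
        have habs : ∀ i, (StrTerm.abs (θ i)).prepend ((sel g n').pats i).length =
            .pebbles (n' i) (y i) := by
          intro i
          have := congr_arg StrTerm.abs (congr_fun hargs i)
          rw [abs_fill, StreamRule.instPat, StrTerm.abs_prepend, List.length_map] at this
          exact this.symm
        have hlen : ∀ i, (((sel g n').pats i).length : ℕ∞) ≤ n' i := by
          intro i
          have := congr_arg AbsTerm.front (habs i)
          rw [AbsTerm.front_prepend, AbsTerm.front_pebbles] at this
          exact this ▸ le_self_add
        have hθ : ∀ i, (θ i).abs = .pebbles (n' i - ((sel g n').pats i).length) (y i) := by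
          intro i
          have := congr_arg (AbsTerm.drop ((sel g n').pats i).length) (habs i)
          rwa [AbsTerm.drop_prepend, AbsTerm.drop_pebbles] at this
        rw [StrTerm.abs_prepend, StrTerm.abs_inst, funext hθ, List.length_replicate]
        cases hrhs : (sel g n').rhs with
        | var cs j =>
          left
          rw [AbsTerm.inst, AbsTerm.prepend_pebbles, AbsTerm.prepend_pebbles]
          refine ⟨_, _, rfl, le_trans ?_ hle⟩
          gcongr
          by_cases hwg : T.WeaklyGuarded g
          · rw [hsel₁ g n' hwg, Valuation.ruleValue_var hrhs hlen]
          · obtain ⟨_, _, _, h, -⟩ := hsel₂ g n' hwg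
            rw [hrhs] at h
            cases h
        | app cs g' args vs =>
          right
          obtain ⟨y', hy'⟩ := inst_pebbles_of_not_nested hrhs hflat n' y
          rw [← hrhs, hy', AbsTerm.prepend]
          refine ⟨_, g', _, y', hg.of_occurs hγ (by rw [hrhs]; exact .inl rfl), rfl,
            le_trans ?_ hle⟩
          push_cast
          rw [add_assoc]
          gcongr
          by_cases hwg : T.WeaklyGuarded g
          · rw [hsel₁ g n' hwg, Valuation.ruleValue_app (hX g') hrhs hflat hlen]
          -- The enforced rule has no prefix and leads to another unguarded symbol, whose value is
          -- 0.
          · obtain ⟨_, _, _, h, hg'⟩ := hsel₂ g n' hwg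
            rw [hrhs] at h
            cases h
            simp [(hX g').fn_of_not hg']
  obtain ⟨n', y, rfl, hle⟩ | ⟨m, g, n', y, -, rfl, hle⟩ := inv
  · rwa [AbsTerm.front_pebbles]
  · exact le_self_add.trans hle

end StreamSpec

theorem mainTheorem1 (T : StreamSpec) (f : T.SSym) (hf : T.FriendlyNesting f) :
    ∃ φ : (Fin (T.sAr f) → ℕ∞) → ℕ∞,
      (∀ ψ, T.IsTranslation f ψ ↔ ψ = φ) ∧
      (T.Flat f → φ = T.doLow f ∧ PeriodicallyIncreasing (T.doLow f)) ∧
      (∀ n, φ n ≤ T.doLow f n) := by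
  -- This solution satisfies the equations for all symbols, so that the periodicity theorem applies
  -- to the entire graph.
  obtain ⟨X, hX⟩ := T.exists_solvesAt
  have hsol := StreamSpec.Valuation.isSolution_of_solvesAt hX
  refine ⟨X.fn f, fun ψ => ⟨?_, fun h => ⟨X, hsol, h.symm⟩⟩, fun hflat => ?_,
    StreamSpec.fn_le_doLow hX hf⟩
  · rintro ⟨X', hX', rfl⟩
    exact hX'.fn_eq hsol hf
  · have heq : X.fn f = T.doLow f := funext fun n =>
      (StreamSpec.fn_le_doLow hX hf n).antisymm (StreamSpec.doLow_le_fn hX hflat n)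
    exact ⟨heq, heq ▸ StreamSpec.Valuation.periodicallyIncreasing_fn hX f⟩
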